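/- Let $\alpha\ge 1$ be real and let $\mathbb{G}_\alpha$ be the $\alpha$-Grushin plane, i.e. the sub-Riemannian structure on $\mathbb{R}^2$ generated by the vector fields $X=\partial_x$ and $Y_\alpha=|x|^\alpha\partial_y$, with Hamiltonian $H(q,\lambda)=\tfrac12\big(\langle\lambda,X(q)\rangle^2+\langle\lambda,Y_\alpha(q)\rangle^2\big)$ on $T^*\mathbb{R}^2$. For $q\in\mathbb{G}_\alpha$, the exponential map $\exp_q$ sends a covector $\lambda_0\in T_q^*(\mathbb{G}_\alpha)$, for which the solution $\lambda(t)$ of Hamilton's equation $\dot\lambda=\overrightarrow{H}(\lambda)$ with $\lambda(0)=(q,\lambda_0)$ exists on all of $[0,1]$, to the base point of $\lambda(1)$. Write $\mathrm{Conj}_q(\mathbb{G}_\alpha)$ for the set of conjugate covectors at $q$, i.e. the covectors $\lambda_0$ in the domain of $\exp_q$ with $\mathrm{Ker}(d_{\lambda_0}\exp_q)\neq\{0\}$. Proposition. For every $q\in\mathbb{G}_\alpha$, the map $\exp_q$ is defined on all of $T_q^*(\mathbb{G}_\alpha)$, and for every conjugate covector $\lambda_0\in\mathrm{Conj}_q(\mathbb{G}_\alpha)$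 and every neighbourhood $U$ of $\lambda_0$ in $T_q^*(\mathbb{G}_\alpha)$, the restriction of $\exp_q$ to $U$ is not injective. -/

import Mathlib

noncomputable section

namespace SubRiem

/-- The cotangent bundle of a vector space `E`, viewed as a manifold: pairs
(base point, covector). -/
abbrev Cotangent (E : Type*) [NormedAddCommGroup E] [NormedSpace ℝ E] : Type _ :=
  E × StrongDual ℝ E

section General

variable {E : Type*} [NormedAddCommGroup E] [NormedSpace ℝ E]

/-- The canonical symplectic form `dp ∧ dq` on the cotangent bundle of `E`. -/
def symplecticForm (w z : Cotangent E) : ℝ := w.2 z.1 - z.2 w.1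

/-- `z` is the value at `p` of the Hamiltonian vector field of `a`, that is
`σ(·, z) = d_p a`. -/
def IsHamiltonianVector (a : Cotangent E → ℝ) (p z : Cotangent E) : Prop :=
  DifferentiableAt ℝ a p ∧ ∀ w : Cotangent E, symplecticForm w z = fderiv ℝ a p w

variable {ι : Type*} [Fintype ι]

/-- The Hamiltonian `H(q, l) = 1/2 ∑ ⟨l, X_k(q)⟩ ^ 2` of the sub-Riemannian structure generated
by the vector fields `X k`. -/
def hamiltonian (X : ι → E → E) (p : Cotangent E) : ℝ :=
  (1 / 2) * ∑ k, (p.2 (X k p.1)) ^ 2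

/-- `γ` solves Hamilton's equation of the structure generated by `X` on the whole of `[0, 1]`
(with one-sided derivatives at the end points). -/
def IsNormalExtremal (X : ι → E → E) (γ : ℝ → Cotangent E) : Prop :=
  ∀ t ∈ Set.Icc (0 : ℝ) 1, ∃ z : Cotangent E,
    IsHamiltonianVector (hamiltonian X) (γ t) z ∧ HasDerivWithinAt γ z (Set.Icc 0 1) t

/-- The set `𝒜_q` of covectors at `q` whose normal extremal is defined on `[0, 1]`. -/
def expDomain (X : ι → E → E) (q : E) : Set (StrongDual ℝ E) :=
  {l | ∃ γ : ℝ → Cotangent E, γ 0 = (q, l) ∧ IsNormalExtremal X γ}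

open Classical in
/-- The sub-Riemannian exponential map at `q`: the base point at time `1` of the normal extremal
that starts at `(q, l)` (with the dummy value `q` for `l` outside `expDomain X q`). -/
def expMap (X : ι → E → E) (q : E) (l : StrongDual ℝ E) : E :=
  if h : ∃ γ : ℝ → Cotangent E, γ 0 = (q, l) ∧ IsNormalExtremal X γ then
    (Classical.choose h 1).1
  else q

/-- The conjugate locus at `q`, a set of covectors at `q`. -/
def conjugateLocus (X : ι → E → E) (q : E) : Set (StrongDual ℝ E) :=
  {l | l ∈ expDomain X q ∧ LinearMap.ker (fderiv ℝ (expMap X q) l).toLinearMap ≠ ⊥}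

end General

/-- The generating vector fields `∂_x` and `|x| ^ α ∂_y` of the `α`-Grushin plane. -/
def grushinFields (α : ℝ) : Fin 2 → ℝ × ℝ → ℝ × ℝ :=
  ![fun _ => (1, 0), fun q => (0, |q.1| ^ α)]

end SubRiem

end

/-!
Coordinates `(u, v)` on covectors `u dx + v dy` turn a normal extremal from `(x₀, y₀)` into a
solution of `x' = p`, `p' = -v² f(x)`, `y' = v |x|^(2α)` with `v` constant, where
`f(x) = α |x|^(2α-2) x` is `force`. As `α ≥ 1`, this field is locally Lipschitz, and the energy
`p² + v² |x|^(2α)` is conserved, so extremals exist on all of `[0, 1]`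
(`exists_isTrajectory`). For `v ≠ 0` the vertical displacement is an explicit function of the end
values of `x` and `p` (`integral_abs_pos_rpow`).

The equation is invariant under translation of time and, after rescaling time, under dilation of
`x`. Hence all solutions near a given one are obtained from it, and the end values of `x` and `p`
depend in a `C¹` way on the covector, with an explicit derivative (`hasFDerivAt_end`). The Jacobian
determinant of the exponential map at `r • (u, v)` is a nonzero multiple of `N r`, where
`N t = (u t + x₀) p(t) - u x(t)` is `conj` (`det_eq_conj`, `conj_smul`). Since
`N' t = -v² (u t + x₀) f(x(t))`, the function `N` is strictly monotone near each of its zeros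
(`not_eventually_conj_nonneg`): the determinant changes sign along the ray through a conjugate
covector. On the other hand the derivative of the exponential map does not kill the direction of the
ray, and a `C¹` map of the plane whose derivative does not vanish at a point and which is injective
near it has a determinant of constant weak sign there (`exists_sign_jacobian_of_injOn`). So the
exponential map is not injective near a conjugate covector with `v ≠ 0`.

Two kinds of covectors remain. If `v = 0` and `(x₀, u) ≠ 0`, the covector is not conjugate
(`ker_eq_bot_of_snd_eq_zero`). If `x₀ = u = 0`, the extremal is constant, and all covectors `(0, v)`
have the same image (`expMap_covector_zero`).
-/

namespace Grushin

open Set Filter Topology MeasureTheory SubRiem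
open scoped NNReal

/-! ### The force -/

/-- Half the derivative of `|x| ^ (2 * α)`: along a normal extremal with vertical covector
component `v`, the horizontal coordinate solves `x'' = - v ^ 2 * force α x`. -/
noncomputable def force (α x : ℝ) : ℝ := α * |x| ^ (2 * α - 2) * x

lemma force_mul_self {α : ℝ} (hα : 1 ≤ α) (x : ℝ) : force α x * x = α * |x| ^ (2 * α) := by
  have h : |x| ^ (2 * α) = |x| ^ (2 * α - 2) * x ^ 2 := by
    rw [← sq_abs x, ← Real.rpow_natCast |x| 2,
      ← Real.rpow_add_of_nonneg (abs_nonneg x) (by linarith) (by norm_num)]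
    norm_num
  rw [force, h]
  ring

lemma hasDerivAt_abs_rpow_two_mul {α : ℝ} (hα : 1 ≤ α) (x : ℝ) :
    HasDerivAt (fun x : ℝ => |x| ^ (2 * α)) (2 * force α x) x := by
  convert hasDerivAt_abs_rpow x (p := 2 * α) (by linarith) using 1
  rw [force]
  ring

lemma force_mul_left {α l : ℝ} (hl : 0 < l) (x : ℝ) :
    force α (l * x) = l ^ (2 * α - 1) * force α x := by
  have h : l ^ (2 * α - 1) = l ^ (2 * α - 2) * l := by
    rw [← Real.rpow_add_one hl.ne']
    ring_nf
  rw [force, force, abs_mul, abs_of_pos hl, Real.mul_rpow hl.le (abs_nonneg x), h]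
  ring

lemma force_ne_zero {α x : ℝ} (hα : 1 ≤ α) (hx : x ≠ 0) : force α x ≠ 0 :=
  mul_ne_zero (mul_ne_zero (by linarith) (Real.rpow_pos_of_pos (abs_pos.2 hx) _).ne') hx

lemma force_zero (α : ℝ) : force α 0 = 0 := by simp [force]

lemma hasDerivAt_force {α : ℝ} (hα : 1 ≤ α) (x : ℝ) :
    HasDerivAt (force α) (α * (2 * α - 1) * |x| ^ (2 * α - 2)) x := by
  have hc : Continuous fun x : ℝ => |x| ^ (2 * α - 2) :=
    continuous_abs.rpow_const fun _ => Or.inr (by linarith)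
  rcases eq_or_ne x 0 with rfl | hx
  · have h : HasDerivAt (force α) (α * |(0 : ℝ)| ^ (2 * α - 2)) 0 := by
      rw [hasDerivAt_iff_tendsto_slope_zero]
      have hc' : Tendsto (fun x : ℝ => α * |x| ^ (2 * α - 2)) (𝓝 0)
          (𝓝 (α * |(0 : ℝ)| ^ (2 * α - 2))) := ((continuous_const (y := α)).mul hc).tendsto 0
      refine (hc'.mono_left (nhdsWithin_le_nhds (s := {(0 : ℝ)}ᶜ))).congr' ?_
      filter_upwards [self_mem_nhdsWithin] with t ht
      have ht : t ≠ 0 := ht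
      simp only [force, zero_add, mul_zero, sub_zero, smul_eq_mul]
      field_simp
    convert h using 1
    rcases hα.eq_or_lt with rfl | hα
    · norm_num
    · rw [abs_zero, Real.zero_rpow (by linarith)]
      ring
  · have h := (((hasDerivAt_abs hx).rpow_const (p := 2 * α - 2)
      (Or.inl (abs_ne_zero.2 hx))).const_mul α).mul (hasDerivAt_id x)
    refine h.congr_deriv ?_
    have h1 : |x| ^ (2 * α - 2) = |x| ^ (2 * α - 2 - 1) * |x| := by
      rw [← Real.rpow_add_one (abs_ne_zero.2 hx)]
      ring_nf
    have h2 : (SignType.sign x : ℝ) * x = |x| := by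
      rw [mul_comm]
      exact self_mul_sign x
    simp only [id]
    rw [h1, ← h2]
    ring

lemma continuous_force {α : ℝ} (hα : 1 ≤ α) : Continuous (force α) :=
  continuous_iff_continuousAt.2 fun x => (hasDerivAt_force hα x).continuousAt

lemma exists_lipschitzOnWith_force {α : ℝ} (hα : 1 ≤ α) (R : ℝ) :
    ∃ K : ℝ≥0, LipschitzOnWith K (force α) (Icc (-R) R) := by
  have h1 : 0 ≤ 2 * α - 1 := by linarith
  have h0 : 0 ≤ α * (2 * α - 1) * |R| ^ (2 * α - 2) := by positivity
  refine ⟨(α * (2 * α - 1) * |R| ^ (2 * α - 2)).toNNReal, ?_⟩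
  refine (convex_Icc _ _).lipschitzOnWith_of_nnnorm_hasDerivWithin_le
    (fun x _ => (hasDerivAt_force hα x).hasDerivWithinAt) fun x hx => ?_
  have hxR : |x| ≤ |R| := (abs_le.2 hx).trans (le_abs_self R)
  have h2 : (0 : ℝ) ≤ |x| ^ (2 * α - 2) := by positivity
  rw [← NNReal.coe_le_coe, Real.coe_toNNReal _ h0, coe_nnnorm, Real.norm_of_nonneg (by positivity)]
  gcongr
  linarith

/-- `x` and `p` solve `x' = p`, `p' = - v ^ 2 * force α x`, the horizontal part of Hamilton's
equation, on `(-2, 2)`. This interval leaves room around `[0, 1]` to translate and rescale time. -/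
structure IsTrajectory (α v : ℝ) (x p : ℝ → ℝ) : Prop where
  hasDerivAt_pos : ∀ t ∈ Ioo (-2 : ℝ) 2, HasDerivAt x (p t) t
  hasDerivAt_mom : ∀ t ∈ Ioo (-2 : ℝ) 2, HasDerivAt p (-(v ^ 2 * force α (x t))) t

/-! ### Solutions of the horizontal equation -/

lemma eq_of_hasDerivWithinAt_zero {s : Set ℝ} (hs : Convex ℝ s) {f : ℝ → ℝ}
    (hf : ∀ t ∈ s, HasDerivWithinAt f 0 s t) {a b : ℝ} (ha : a ∈ s) (hb : b ∈ s) : f a = f b := by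
  have h := hs.norm_image_sub_le_of_norm_hasDerivWithin_le (C := 0) hf (by simp) hb ha
  simpa [sub_eq_zero] using h

/-- Existence for the horizontal part of Hamilton's equation. The field is cut off outside a box, so
that Picard-Lindelöf applies on the whole of `[-2, 2]`; conservation of energy then shows that the
solution never leaves the region where nothing was cut off. -/
theorem exists_isTrajectory {α : ℝ} (hα : 1 ≤ α) (x₀ u v : ℝ) :
    ∃ x p : ℝ → ℝ, x 0 = x₀ ∧ p 0 = u ∧ IsTrajectory α v x p := by
  set c := Real.sqrt (u ^ 2 + v ^ 2 * |x₀| ^ (2 * α)) with hc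
  have hc0 : 0 ≤ c := Real.sqrt_nonneg _
  have hc2 : c ^ 2 = u ^ 2 + v ^ 2 * |x₀| ^ (2 * α) := Real.sq_sqrt (by positivity)
  set R := |x₀| + 2 * c with hR
  have hR0 : 0 ≤ R := by positivity
  obtain ⟨K, hK⟩ := exists_lipschitzOnWith_force hα R
  obtain ⟨B, hB⟩ := isCompact_Icc.exists_bound_of_continuousOn
    ((continuous_force hα).continuousOn (s := Icc (-R) R))
  have hB0 : 0 ≤ B := (norm_nonneg _).trans (hB 0 ⟨by linarith, hR0⟩)
  -- `g` is the force, frozen outside `[-R, R]`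
  set g : ℝ → ℝ := fun x => force α (max (-R) (min x R)) with hg
  have hmem : ∀ x, max (-R) (min x R) ∈ Icc (-R) R := fun x =>
    ⟨le_max_left _ _, max_le (by linarith) (min_le_right _ _)⟩
  have hgB : ∀ x, |g x| ≤ B := fun x => hB _ (hmem x)
  have hgc : Continuous g := (continuous_force hα).comp (by fun_prop)
  have hgf : ∀ x ∈ Icc (-R) R, g x = force α x := by
    intro x hx
    simp only [hg, min_eq_left hx.2, max_eq_right hx.1]
  have hclip : ∀ a : ℝ, LipschitzWith 1 fun x : ℝ => max (-a) (min x a) := fun a =>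
    (LipschitzWith.id.min_const a).const_max (-a)
  have hgL : LipschitzWith K g := by
    have := hK.comp ((hclip R).lipschitzOnWith (s := univ)) fun x _ => hmem x
    rw [mul_one] at this
    exact lipschitzOnWith_univ.1 this
  set M := |u| + 2 * (v ^ 2 * B) with hM
  have hM0 : 0 ≤ M := by positivity
  set V : ℝ × ℝ → ℝ × ℝ := fun z => (max (-M) (min z.2 M), -(v ^ 2 * g z.1)) with hV
  obtain ⟨K', hVL⟩ : ∃ K', LipschitzWith K' V := by
    have h1 := (hclip M).comp (LipschitzWith.prod_snd (α := ℝ) (β := ℝ))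
    have h2 : LipschitzWith (‖v ^ 2‖₊ * K) fun x => -(v ^ 2 * g x) := by
      refine LipschitzWith.of_dist_le_mul fun x y => ?_
      have := hgL.dist_le_mul x y
      rw [Real.dist_eq] at this ⊢
      rw [neg_sub_neg, abs_sub_comm, ← mul_sub, abs_mul, NNReal.coe_mul, mul_assoc]
      exact mul_le_mul_of_nonneg_left this (abs_nonneg _)
    exact ⟨_, h1.prodMk (h2.comp (LipschitzWith.prod_fst (α := ℝ) (β := ℝ)))⟩
  have hVb : ∀ z, ‖V z‖ ≤ M + v ^ 2 * B := by
    intro z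
    have h1 : |max (-M) (min z.2 M)| ≤ M :=
      abs_le.2 ⟨le_max_left _ _, max_le (by linarith) (min_le_right _ _)⟩
    have h2 : |-(v ^ 2 * g z.1)| ≤ v ^ 2 * B := by
      rw [abs_neg, abs_mul, abs_of_nonneg (sq_nonneg v)]
      exact mul_le_mul_of_nonneg_left (hgB _) (sq_nonneg v)
    have h3 : 0 ≤ v ^ 2 * B := by positivity
    exact max_le (h1.trans (by linarith)) (h2.trans (by linarith))
  have hL0 : 0 ≤ M + v ^ 2 * B := by positivity
  have h0mem : (0 : ℝ) ∈ Icc (-2 : ℝ) 2 := by norm_num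
  have hPL : IsPicardLindelof (fun _ => V) (⟨0, h0mem⟩ : Icc (-2 : ℝ) 2) (x₀, u)
      (2 * (M + v ^ 2 * B).toNNReal) 0 (M + v ^ 2 * B).toNNReal K' := by
    refine ⟨fun t _ => hVL.lipschitzOnWith, fun x _ => continuousOn_const, fun t _ z _ => ?_, ?_⟩
    · rw [Real.coe_toNNReal _ hL0]
      exact hVb z
    · rw [NNReal.coe_mul, Real.coe_toNNReal _ hL0]
      norm_num
      linarith
  obtain ⟨γ, hγ0, hγ⟩ := hPL.exists_eq_forall_mem_Icc_hasDerivWithinAt₀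
  have hcv : Convex ℝ (Icc (-2 : ℝ) 2) := convex_Icc _ _
  have hp' : ∀ t ∈ Icc (-2 : ℝ) 2,
      HasDerivWithinAt (fun t => (γ t).2) (-(v ^ 2 * g (γ t).1)) (Icc (-2) 2) t :=
    fun t ht => (hγ t ht).snd
  have habs : ∀ t ∈ Icc (-2 : ℝ) 2, |t| ≤ 2 := fun t ht => abs_le.2 ht
  have hpM : ∀ t ∈ Icc (-2 : ℝ) 2, |(γ t).2| ≤ M := by
    intro t ht
    have h := hcv.norm_image_sub_le_of_norm_hasDerivWithin_le (C := v ^ 2 * B) hp'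
      (fun s _ => by
        rw [Real.norm_eq_abs, abs_neg, abs_mul, abs_of_nonneg (sq_nonneg v)]
        exact mul_le_mul_of_nonneg_left (hgB _) (sq_nonneg v)) h0mem ht
    simp only [hγ0, sub_zero, Real.norm_eq_abs] at h
    have h2 : v ^ 2 * B * |t| ≤ v ^ 2 * B * 2 :=
      mul_le_mul_of_nonneg_left (habs t ht) (by positivity)
    have h3 := abs_sub_abs_le_abs_sub (γ t).2 u
    rw [hM]
    linarith
  have hx' : ∀ t ∈ Icc (-2 : ℝ) 2,
      HasDerivWithinAt (fun t => (γ t).1) (γ t).2 (Icc (-2) 2) t := by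
    intro t ht
    have h : HasDerivWithinAt (fun t => (γ t).1) (V (γ t)).1 (Icc (-2) 2) t := (hγ t ht).fst
    have hb := abs_le.1 (hpM t ht)
    simpa only [hV, min_eq_left hb.2, max_eq_right hb.1] using h
  -- the energy of the truncated system
  set G : ℝ → ℝ := fun x => ∫ s in (0 : ℝ)..x, g s with hG
  have hG' : ∀ x, HasDerivAt G (g x) x := fun x =>
    intervalIntegral.integral_hasDerivAt_right (hgc.intervalIntegrable _ _)
      (hgc.stronglyMeasurableAtFilter _ _) hgc.continuousAt
  have hGx₀ : G x₀ = |x₀| ^ (2 * α) / 2 := by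
    have h1 : ∀ s ∈ uIcc 0 x₀, g s = force α s := by
      intro s hs
      refine hgf s (abs_le.1 ?_)
      have : |s| ≤ |x₀| := by
        have := abs_sub_left_of_mem_uIcc hs
        simpa using this
      linarith
    have h2 : ∀ s ∈ uIcc 0 x₀, HasDerivAt (fun s => |s| ^ (2 * α) / 2) (force α s) s := by
      intro s _
      refine ((hasDerivAt_abs_rpow_two_mul hα s).div_const 2).congr_deriv (by ring)
    rw [hG]
    simp only
    rw [intervalIntegral.integral_congr h1, intervalIntegral.integral_eq_sub_of_hasDerivAt h2
      ((continuous_force hα).intervalIntegrable _ _), abs_zero, Real.zero_rpow (by linarith)]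
    ring
  have hGnn : ∀ x, 0 ≤ G x := by
    intro x
    rcases le_total 0 x with hx | hx
    · refine intervalIntegral.integral_nonneg hx fun s hs => ?_
      exact mul_nonneg (by positivity) (le_max_of_le_right (le_min hs.1 hR0))
    · rw [hG]
      simp only
      rw [intervalIntegral.integral_symm, ← intervalIntegral.integral_neg]
      refine intervalIntegral.integral_nonneg hx fun s hs => ?_
      rw [Left.nonneg_neg_iff]
      exact mul_nonpos_of_nonneg_of_nonpos (by positivity)
        (max_le (by linarith) (min_le_of_left_le hs.2))
  have hE : ∀ t ∈ Icc (-2 : ℝ) 2, (γ t).2 ^ 2 + 2 * v ^ 2 * G (γ t).1 = c ^ 2 := by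
    intro t ht
    have h : ∀ s ∈ Icc (-2 : ℝ) 2, HasDerivWithinAt
        (fun t => (γ t).2 ^ 2 + 2 * v ^ 2 * G (γ t).1) 0 (Icc (-2) 2) s := by
      intro s hs
      have h1 := ((hp' s hs).pow 2).add
        (((hG' (γ s).1).comp_hasDerivWithinAt s (hx' s hs)).const_mul (2 * v ^ 2))
      refine h1.congr_deriv ?_
      push_cast
      ring
    rw [eq_of_hasDerivWithinAt_zero hcv h ht h0mem, hγ0, hGx₀, hc2]
    ring
  have hpc : ∀ t ∈ Icc (-2 : ℝ) 2, |(γ t).2| ≤ c := by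
    intro t ht
    refine abs_le_of_sq_le_sq ?_ hc0
    have h1 : 0 ≤ 2 * v ^ 2 * G (γ t).1 := mul_nonneg (by positivity) (hGnn _)
    linarith [hE t ht]
  have hxR : ∀ t ∈ Icc (-2 : ℝ) 2, (γ t).1 ∈ Icc (-R) R := by
    intro t ht
    have h := hcv.norm_image_sub_le_of_norm_hasDerivWithin_le (C := c) hx' hpc h0mem ht
    simp only [hγ0, sub_zero, Real.norm_eq_abs] at h
    have h2 : c * |t| ≤ c * 2 := mul_le_mul_of_nonneg_left (habs t ht) hc0
    have h3 := abs_sub_abs_le_abs_sub (γ t).1 x₀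
    refine abs_le.1 ?_
    linarith
  refine ⟨fun t => (γ t).1, fun t => (γ t).2, by simp [hγ0], by simp [hγ0],
    fun t ht => (hx' t (Ioo_subset_Icc_self ht)).hasDerivAt (Icc_mem_nhds ht.1 ht.2), fun t ht => ?_⟩
  have h := (hp' t (Ioo_subset_Icc_self ht)).hasDerivAt (Icc_mem_nhds ht.1 ht.2)
  rwa [hgf _ (hxR t (Ioo_subset_Icc_self ht))] at h

/-- Uniqueness for the horizontal part of Hamilton's equation, on `[0, 1]`. -/
theorem eqOn_of_hasDerivWithinAt {α : ℝ} (hα : 1 ≤ α) (v : ℝ) {x p y q : ℝ → ℝ}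
    (hx : ∀ t ∈ Icc (0 : ℝ) 1, HasDerivWithinAt x (p t) (Icc 0 1) t)
    (hp : ∀ t ∈ Icc (0 : ℝ) 1, HasDerivWithinAt p (-(v ^ 2 * force α (x t))) (Icc 0 1) t)
    (hy : ∀ t ∈ Icc (0 : ℝ) 1, HasDerivWithinAt y (q t) (Icc 0 1) t)
    (hq : ∀ t ∈ Icc (0 : ℝ) 1, HasDerivWithinAt q (-(v ^ 2 * force α (y t))) (Icc 0 1) t)
    (h0 : x 0 = y 0) (h1 : p 0 = q 0) :
    ∀ t ∈ Icc (0 : ℝ) 1, x t = y t ∧ p t = q t := by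
  have hxc : ContinuousOn x (Icc 0 1) := fun t ht => (hx t ht).continuousWithinAt
  have hpc : ContinuousOn p (Icc 0 1) := fun t ht => (hp t ht).continuousWithinAt
  have hyc : ContinuousOn y (Icc 0 1) := fun t ht => (hy t ht).continuousWithinAt
  have hqc : ContinuousOn q (Icc 0 1) := fun t ht => (hq t ht).continuousWithinAt
  obtain ⟨A, hA⟩ := isCompact_Icc.exists_bound_of_continuousOn hxc
  obtain ⟨A', hA'⟩ := isCompact_Icc.exists_bound_of_continuousOn hyc
  obtain ⟨K, hK⟩ := exists_lipschitzOnWith_force hα (max A A')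
  set V : ℝ × ℝ → ℝ × ℝ := fun z => (z.2, -(v ^ 2 * force α z.1)) with hV
  set S : Set (ℝ × ℝ) := Icc (-max A A') (max A A') ×ˢ univ with hS
  have hVL : LipschitzOnWith (max 1 (‖v ^ 2‖₊ * K)) V S := by
    refine LipschitzOnWith.of_dist_le_mul fun z hz w hw => ?_
    have h1 := hK.dist_le_mul z.1 hz.1 w.1 hw.1
    rw [Prod.dist_eq]
    refine max_le ?_ ?_
    · have h2 : dist z.2 w.2 ≤ dist z w := le_max_right _ _
      refine h2.trans (le_mul_of_one_le_left dist_nonneg ?_)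
      exact_mod_cast le_max_left _ _
    · have h2 : dist z.1 w.1 ≤ dist z w := le_max_left _ _
      calc dist (-(v ^ 2 * force α z.1)) (-(v ^ 2 * force α w.1))
          = ‖v ^ 2‖ * dist (force α z.1) (force α w.1) := by
            rw [dist_neg_neg, Real.dist_eq, Real.dist_eq, ← mul_sub, abs_mul, Real.norm_eq_abs]
        _ ≤ ‖v ^ 2‖ * (K * dist z.1 w.1) := by gcongr
        _ ≤ (‖v ^ 2‖₊ * K : ℝ≥0) * dist z w := by
            rw [NNReal.coe_mul, coe_nnnorm, mul_assoc]
            gcongr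
        _ ≤ _ := by
            gcongr
            exact le_max_right _ _
  have hIci : ∀ {f : ℝ → ℝ × ℝ} {f' : ℝ × ℝ} {t : ℝ}, t ∈ Ico (0 : ℝ) 1 →
      HasDerivWithinAt f f' (Icc 0 1) t → HasDerivWithinAt f f' (Ici t) t := by
    intro f f' t ht h
    exact h.mono_of_mem_nhdsWithin
      (mem_of_superset (Icc_mem_nhdsGE ht.2) (Icc_subset_Icc_left ht.1))
  have key := ODE_solution_unique_of_mem_Icc_right (v := fun _ => V) (s := fun _ => S)
    (f := fun t => (x t, p t)) (g := fun t => (y t, q t)) (a := 0) (b := 1)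
    (fun t _ => hVL) (hxc.prodMk hpc)
    (fun t ht => hIci ht ((hx t (Ico_subset_Icc_self ht)).prodMk (hp t (Ico_subset_Icc_self ht))))
    (fun t ht => ⟨abs_le.1 ((hA t (Ico_subset_Icc_self ht)).trans (le_max_left _ _)), mem_univ _⟩)
    (hyc.prodMk hqc)
    (fun t ht => hIci ht ((hy t (Ico_subset_Icc_self ht)).prodMk (hq t (Ico_subset_Icc_self ht))))
    (fun t ht => ⟨abs_le.1 ((hA' t (Ico_subset_Icc_self ht)).trans (le_max_right _ _)), mem_univ _⟩)
    (by simp only [h0, h1])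
  intro t ht
  have := key ht
  exact ⟨congrArg Prod.fst this, congrArg Prod.snd this⟩

/-- Conservation of energy. -/
lemma IsTrajectory.energy {α v : ℝ} (hα : 1 ≤ α) {x p : ℝ → ℝ} (h : IsTrajectory α v x p)
    {t : ℝ} (ht : t ∈ Ioo (-2 : ℝ) 2) :
    p t ^ 2 + v ^ 2 * |x t| ^ (2 * α) = p 0 ^ 2 + v ^ 2 * |x 0| ^ (2 * α) := by
  refine eq_of_hasDerivWithinAt_zero (f := fun t => p t ^ 2 + v ^ 2 * |x t| ^ (2 * α))
    (convex_Ioo (-2 : ℝ) 2) (fun s hs => ?_) ht (by norm_num)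
  have h1 := ((h.hasDerivAt_mom s hs).pow 2).add
    (((hasDerivAt_abs_rpow_two_mul hα (x s)).comp s (h.hasDerivAt_pos s hs)).const_mul (v ^ 2))
  refine (h1.congr_deriv ?_).hasDerivWithinAt
  push_cast
  ring

/-! ### The exponential map in coordinates -/

/-- Covectors of the plane in coordinates: `(u, v)` stands for `u dx + v dy`. -/
noncomputable def covector : (ℝ × ℝ) ≃L[ℝ] StrongDual ℝ (ℝ × ℝ) :=
  LinearEquiv.toContinuousLinearEquiv
    { toFun := fun w => w.1 • ContinuousLinearMap.fst ℝ ℝ ℝ + w.2 • ContinuousLinearMap.snd ℝ ℝ ℝ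
      invFun := fun l => (l (1, 0), l (0, 1))
      map_add' := fun w z => by
        ext <;> simp
      map_smul' := fun c w => by
        ext <;> simp
      left_inv := fun w => by simp
      right_inv := fun l => by
        ext <;> simp }

@[simp] lemma covector_apply (w z : ℝ × ℝ) : covector w z = w.1 * z.1 + w.2 * z.2 := rfl

lemma dual_apply (l : StrongDual ℝ (ℝ × ℝ)) (z : ℝ × ℝ) : l z = l (1, 0) * z.1 + l (0, 1) * z.2 := by
  conv_lhs => rw [← covector.apply_symm_apply l]
  rfl

lemma hamiltonian_grushinFields (α : ℝ) (p : Cotangent (ℝ × ℝ)) :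
    hamiltonian (grushinFields α) p =
      1 / 2 * ((p.2 (1, 0)) ^ 2 + |p.1.1| ^ (2 * α) * (p.2 (0, 1)) ^ 2) := by
  have h1 : p.2 (0, |p.1.1| ^ α) = |p.1.1| ^ α * p.2 (0, 1) := by
    rw [dual_apply]
    ring
  have h2 : |p.1.1| ^ (2 * α) = (|p.1.1| ^ α) ^ 2 := by
    rw [mul_comm, Real.rpow_mul (abs_nonneg _), Real.rpow_two]
  simp only [hamiltonian, grushinFields, Fin.sum_univ_two, Matrix.cons_val_zero,
    Matrix.cons_val_one, h1, h2]
  ring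

/-- The Hamiltonian vector field of the Grushin plane. -/
noncomputable def hamiltonianField (α : ℝ) (p : Cotangent (ℝ × ℝ)) : Cotangent (ℝ × ℝ) :=
  ((p.2 (1, 0), p.2 (0, 1) * |p.1.1| ^ (2 * α)),
    covector (-((p.2 (0, 1)) ^ 2 * force α p.1.1), 0))

lemma hasFDerivAt_hamiltonian {α : ℝ} (hα : 1 ≤ α) (p : Cotangent (ℝ × ℝ)) :
    ∃ D : Cotangent (ℝ × ℝ) →L[ℝ] ℝ, HasFDerivAt (hamiltonian (grushinFields α)) D p ∧
      ∀ w, D w = symplecticForm w (hamiltonianField α p) := by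
  have he : ∀ z : ℝ × ℝ, HasFDerivAt (fun p : Cotangent (ℝ × ℝ) => p.2 z)
      ((ContinuousLinearMap.apply ℝ ℝ z).comp
        (ContinuousLinearMap.snd ℝ (ℝ × ℝ) (StrongDual ℝ (ℝ × ℝ)))) p := fun z =>
    ((ContinuousLinearMap.apply ℝ ℝ z).comp
        (ContinuousLinearMap.snd ℝ (ℝ × ℝ) (StrongDual ℝ (ℝ × ℝ)))).hasFDerivAt
  have hx : HasFDerivAt (fun p : Cotangent (ℝ × ℝ) => p.1.1)
      ((ContinuousLinearMap.fst ℝ ℝ ℝ).comp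
        (ContinuousLinearMap.fst ℝ (ℝ × ℝ) (StrongDual ℝ (ℝ × ℝ)))) p :=
    ((ContinuousLinearMap.fst ℝ ℝ ℝ).comp
        (ContinuousLinearMap.fst ℝ (ℝ × ℝ) (StrongDual ℝ (ℝ × ℝ)))).hasFDerivAt
  have hr := (hasDerivAt_abs_rpow_two_mul hα p.1.1).comp_hasFDerivAt p hx
  have h := (((he (1, 0)).pow 2).add (hr.mul ((he (0, 1)).pow 2))).const_mul (1 / 2 : ℝ)
  refine ⟨_, h.congr_of_eventuallyEq
    (Eventually.of_forall fun p => hamiltonian_grushinFields α p), fun w => ?_⟩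
  have hw := dual_apply w.2 (p.2 (1, 0), p.2 (0, 1) * |p.1.1| ^ (2 * α))
  simp only [symplecticForm, hamiltonianField, hw]
  simp
  ring

lemma isHamiltonianVector_iff {α : ℝ} (hα : 1 ≤ α) (p z : Cotangent (ℝ × ℝ)) :
    IsHamiltonianVector (hamiltonian (grushinFields α)) p z ↔ z = hamiltonianField α p := by
  obtain ⟨D, hD, hDw⟩ := hasFDerivAt_hamiltonian hα p
  constructor
  · rintro ⟨-, h⟩
    rw [hD.fderiv] at h
    have h' : ∀ w, symplecticForm w z = symplecticForm w (hamiltonianField α p) := fun w => by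
      rw [h, hDw]
    have h1 := h' (0, covector (1, 0))
    have h2 := h' (0, covector (0, 1))
    have h3 := h' ((1, 0), 0)
    have h4 := h' ((0, 1), 0)
    simp [symplecticForm] at h1 h2 h3 h4
    refine Prod.ext (Prod.ext h1 h2) ?_
    refine ContinuousLinearMap.ext fun w => ?_
    rw [dual_apply, h3, h4, ← dual_apply]
  · rintro rfl
    exact ⟨hD.differentiableAt, fun w => by rw [hD.fderiv, hDw]⟩

lemma isNormalExtremal_iff {α : ℝ} (hα : 1 ≤ α) (γ : ℝ → Cotangent (ℝ × ℝ)) :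
    IsNormalExtremal (grushinFields α) γ ↔
      ∀ t ∈ Icc (0 : ℝ) 1, HasDerivWithinAt γ (hamiltonianField α (γ t)) (Icc 0 1) t := by
  simp [IsNormalExtremal, isHamiltonianVector_iff hα]

lemma IsTrajectory.continuousOn {α v : ℝ} {x p : ℝ → ℝ} (h : IsTrajectory α v x p) :
    ContinuousOn x (Ioo (-2) 2) :=
  fun t ht => (h.hasDerivAt_pos t ht).continuousAt.continuousWithinAt

lemma Icc_subset_Ioo_two : Icc (0 : ℝ) 1 ⊆ Ioo (-2) 2 := Icc_subset_Ioo (by norm_num) (by norm_num)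

lemma IsTrajectory.continuousOn_abs_rpow {α v : ℝ} (hα : 1 ≤ α) {x p : ℝ → ℝ}
    (h : IsTrajectory α v x p) : ContinuousOn (fun t => |x t| ^ (2 * α)) (Ioo (-2) 2) :=
  h.continuousOn.abs.rpow_const fun _ _ => Or.inr (by linarith)

lemma IsTrajectory.hasDerivAt_integral {α v : ℝ} (hα : 1 ≤ α) {x p : ℝ → ℝ}
    (h : IsTrajectory α v x p) {t : ℝ} (ht : t ∈ Icc (0 : ℝ) 1) :
    HasDerivAt (fun t => ∫ s in (0 : ℝ)..t, |x s| ^ (2 * α)) (|x t| ^ (2 * α)) t := by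
  have hc := h.continuousOn_abs_rpow hα
  have ht' := Icc_subset_Ioo_two ht
  refine intervalIntegral.integral_hasDerivAt_right ?_
    (hc.stronglyMeasurableAtFilter isOpen_Ioo t ht') (hc.continuousAt (isOpen_Ioo.mem_nhds ht'))
  refine (hc.mono ?_).intervalIntegrable
  rw [uIcc_of_le ht.1]
  exact (Icc_subset_Icc_right ht.2).trans Icc_subset_Ioo_two

/-- The normal extremal lying over a solution of the horizontal part of Hamilton's equation. -/
lemma IsTrajectory.isNormalExtremal {α v : ℝ} (hα : 1 ≤ α) {x p : ℝ → ℝ}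
    (h : IsTrajectory α v x p) (y₀ : ℝ) :
    IsNormalExtremal (grushinFields α) fun t =>
      ((x t, y₀ + v * ∫ s in (0 : ℝ)..t, |x s| ^ (2 * α)), covector (p t, v)) := by
  rw [isNormalExtremal_iff hα]
  intro t ht
  have ht' := Icc_subset_Ioo_two ht
  have h1 := h.hasDerivAt_pos t ht'
  have h2 := ((h.hasDerivAt_integral hα ht).const_mul v).const_add y₀
  have h3 : HasDerivAt (fun t => covector (p t, v)) (covector (-(v ^ 2 * force α (x t)), 0)) t :=
    covector.toContinuousLinearMap.hasFDerivAt.comp_hasDerivAt t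
      ((h.hasDerivAt_mom t ht').prodMk (hasDerivAt_const t v))
  have h4 := ((h1.prodMk h2).prodMk h3).hasDerivWithinAt (s := Icc 0 1)
  simpa [hamiltonianField] using h4

/-- Every normal extremal lies over a solution of the horizontal part of Hamilton's equation. -/
lemma base_eq_of_isNormalExtremal {α v : ℝ} (hα : 1 ≤ α) {x p : ℝ → ℝ}
    (h : IsTrajectory α v x p) {γ : ℝ → Cotangent (ℝ × ℝ)}
    (hγ : IsNormalExtremal (grushinFields α) γ)
    {y₀ : ℝ} (h0 : γ 0 = ((x 0, y₀), covector (p 0, v))) :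
    (γ 1).1 = (x 1, y₀ + v * ∫ s in (0 : ℝ)..1, |x s| ^ (2 * α)) := by
  rw [isNormalExtremal_iff hα] at hγ
  have hcv : Convex ℝ (Icc (0 : ℝ) 1) := convex_Icc _ _
  have zero_mem : (0 : ℝ) ∈ Icc (0 : ℝ) 1 := by norm_num
  have one_mem : (1 : ℝ) ∈ Icc (0 : ℝ) 1 := by norm_num
  have hq : ∀ t ∈ Icc (0 : ℝ) 1,
      HasDerivWithinAt (fun t => (γ t).1) (hamiltonianField α (γ t)).1 (Icc 0 1) t :=
    fun t ht => (hγ t ht).fst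
  have hl : ∀ t ∈ Icc (0 : ℝ) 1,
      HasDerivWithinAt (fun t => covector.symm (γ t).2)
        (covector.symm (hamiltonianField α (γ t)).2) (Icc 0 1) t :=
    fun t ht => covector.symm.toContinuousLinearMap.hasFDerivAt.comp_hasDerivWithinAt t
      (hγ t ht).snd
  have hv : ∀ t ∈ Icc (0 : ℝ) 1, (γ t).2 (0, 1) = v := by
    intro t ht
    have h1 : ∀ s ∈ Icc (0 : ℝ) 1, HasDerivWithinAt (fun s => (γ s).2 (0, 1)) 0 (Icc 0 1) s := by
      intro s hs
      have h2 : HasDerivWithinAt (fun s => (γ s).2 (0, 1)) _ (Icc 0 1) s := (hl s hs).snd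
      refine h2.congr_deriv ?_
      simp [hamiltonianField]
    rw [eq_of_hasDerivWithinAt_zero hcv h1 ht zero_mem, h0]
    simp
  have hX : ∀ t ∈ Icc (0 : ℝ) 1,
      HasDerivWithinAt (fun t => (γ t).1.1) ((γ t).2 (1, 0)) (Icc 0 1) t :=
    fun t ht => (hq t ht).fst
  have hP : ∀ t ∈ Icc (0 : ℝ) 1, HasDerivWithinAt (fun t => (γ t).2 (1, 0))
      (-(v ^ 2 * force α (γ t).1.1)) (Icc 0 1) t := by
    intro t ht
    have h2 : HasDerivWithinAt (fun s => (γ s).2 (1, 0)) _ (Icc 0 1) t := (hl t ht).fst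
    refine h2.congr_deriv ?_
    simp [hamiltonianField, hv t ht]
  have hxp := eqOn_of_hasDerivWithinAt hα v hX hP
    (fun t ht => (h.hasDerivAt_pos t (Icc_subset_Ioo_two ht)).hasDerivWithinAt)
    (fun t ht => (h.hasDerivAt_mom t (Icc_subset_Ioo_two ht)).hasDerivWithinAt)
    (by simp [h0]) (by simp [h0])
  have hY : ∀ t ∈ Icc (0 : ℝ) 1, HasDerivWithinAt
      (fun t => (γ t).1.2 - v * ∫ s in (0 : ℝ)..t, |x s| ^ (2 * α)) 0 (Icc 0 1) t := by
    intro t ht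
    have h1 : HasDerivWithinAt (fun t => (γ t).1.2) _ (Icc 0 1) t := (hq t ht).snd
    refine (h1.sub ((h.hasDerivAt_integral hα ht).const_mul v).hasDerivWithinAt).congr_deriv ?_
    simp [hamiltonianField, hv t ht, (hxp t ht).1]
  have hy := eq_of_hasDerivWithinAt_zero hcv hY one_mem zero_mem
  simp only [intervalIntegral.integral_same, h0, mul_zero, sub_zero] at hy
  exact Prod.ext (hxp 1 one_mem).1 (sub_eq_iff_eq_add.1 hy)

lemma IsTrajectory.mem_expDomain {α v : ℝ} (hα : 1 ≤ α) {x p : ℝ → ℝ}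
    (h : IsTrajectory α v x p) (y₀ : ℝ) :
    covector (p 0, v) ∈ expDomain (grushinFields α) (x 0, y₀) :=
  ⟨_, by simp, h.isNormalExtremal hα y₀⟩

lemma IsTrajectory.expMap_eq {α v : ℝ} (hα : 1 ≤ α) {x p : ℝ → ℝ}
    (h : IsTrajectory α v x p) (y₀ : ℝ) :
    expMap (grushinFields α) (x 0, y₀) (covector (p 0, v)) =
      (x 1, y₀ + v * ∫ s in (0 : ℝ)..1, |x s| ^ (2 * α)) := by
  have hex : ∃ γ : ℝ → Cotangent (ℝ × ℝ), γ 0 = ((x 0, y₀), covector (p 0, v)) ∧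
      IsNormalExtremal (grushinFields α) γ := h.mem_expDomain hα y₀
  rw [expMap, dif_pos hex]
  exact base_eq_of_isNormalExtremal hα h (Classical.choose_spec hex).2 (Classical.choose_spec hex).1

/-- The horizontal coordinate along the normal extremal with initial point `x₀` and initial
covector `w.1 dx + w.2 dy`. -/
noncomputable def pos {α : ℝ} (hα : 1 ≤ α) (x₀ : ℝ) (w : ℝ × ℝ) : ℝ → ℝ :=
  (exists_isTrajectory hα x₀ w.1 w.2).choose

/-- The horizontal covector component along the normal extremal with initial point `x₀` and
initial covector `w.1 dx + w.2 dy`. -/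
noncomputable def mom {α : ℝ} (hα : 1 ≤ α) (x₀ : ℝ) (w : ℝ × ℝ) : ℝ → ℝ :=
  (exists_isTrajectory hα x₀ w.1 w.2).choose_spec.choose

section

variable {α : ℝ} (hα : 1 ≤ α) (x₀ : ℝ) (w : ℝ × ℝ)

lemma pos_zero : pos hα x₀ w 0 = x₀ :=
  (exists_isTrajectory hα x₀ w.1 w.2).choose_spec.choose_spec.1

lemma mom_zero : mom hα x₀ w 0 = w.1 :=
  (exists_isTrajectory hα x₀ w.1 w.2).choose_spec.choose_spec.2.1

lemma isTrajectory_pos_mom : IsTrajectory α w.2 (pos hα x₀ w) (mom hα x₀ w) :=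
  (exists_isTrajectory hα x₀ w.1 w.2).choose_spec.choose_spec.2.2

/-- The exponential map in coordinates. -/
lemma expMap_covector (y₀ : ℝ) : expMap (grushinFields α) (x₀, y₀) (covector w) =
    (pos hα x₀ w 1, y₀ + w.2 * ∫ s in (0 : ℝ)..1, |pos hα x₀ w s| ^ (2 * α)) := by
  have h := (isTrajectory_pos_mom hα x₀ w).expMap_eq hα y₀
  rw [pos_zero, mom_zero] at h
  simpa using h

lemma energy_pos_mom {t : ℝ} (ht : t ∈ Ioo (-2 : ℝ) 2) :
    mom hα x₀ w t ^ 2 + w.2 ^ 2 * |pos hα x₀ w t| ^ (2 * α) =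
      w.1 ^ 2 + w.2 ^ 2 * |x₀| ^ (2 * α) := by
  rw [(isTrajectory_pos_mom hα x₀ w).energy hα ht, pos_zero, mom_zero]

/-- Any solution with the right initial values can be used to compute `pos` and `mom`. -/
lemma pos_mom_eq {x p : ℝ → ℝ}
    (hx : ∀ t ∈ Icc (0 : ℝ) 1, HasDerivAt x (p t) t)
    (hp : ∀ t ∈ Icc (0 : ℝ) 1, HasDerivAt p (-(w.2 ^ 2 * force α (x t))) t)
    (h0 : x 0 = x₀) (h1 : p 0 = w.1) {t : ℝ} (ht : t ∈ Icc (0 : ℝ) 1) :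
    pos hα x₀ w t = x t ∧ mom hα x₀ w t = p t := by
  have h := isTrajectory_pos_mom hα x₀ w
  exact eqOn_of_hasDerivWithinAt hα w.2
    (fun t ht => (h.hasDerivAt_pos t (Icc_subset_Ioo_two ht)).hasDerivWithinAt)
    (fun t ht => (h.hasDerivAt_mom t (Icc_subset_Ioo_two ht)).hasDerivWithinAt)
    (fun t ht => (hx t ht).hasDerivWithinAt) (fun t ht => (hp t ht).hasDerivWithinAt)
    (by rw [pos_zero, h0]) (by rw [mom_zero, h1]) t ht

/-- The vertical displacement is an explicit function of the horizontal data, because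
`(x p)' = p² + v² |x|^(2α) - (1 + α) v² |x|^(2α)`, where the first two terms are the energy. -/
lemma integral_abs_pos_rpow :
    (1 + α) * w.2 ^ 2 * ∫ s in (0 : ℝ)..1, |pos hα x₀ w s| ^ (2 * α) =
      w.1 ^ 2 + w.2 ^ 2 * |x₀| ^ (2 * α) - pos hα x₀ w 1 * mom hα x₀ w 1 + x₀ * w.1 := by
  have h := isTrajectory_pos_mom hα x₀ w
  set C := w.1 ^ 2 + w.2 ^ 2 * |x₀| ^ (2 * α) with hC
  have h1 : ∀ t ∈ Icc (0 : ℝ) 1, HasDerivWithinAt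
      (fun t => ((1 + α) * w.2 ^ 2 * ∫ s in (0 : ℝ)..t, |pos hα x₀ w s| ^ (2 * α)) - C * t
        + pos hα x₀ w t * mom hα x₀ w t) 0 (Icc 0 1) t := by
    intro t ht
    have ht' := Icc_subset_Ioo_two ht
    refine HasDerivAt.hasDerivWithinAt ?_
    refine ((((h.hasDerivAt_integral hα ht).const_mul ((1 + α) * w.2 ^ 2)).sub
      ((hasDerivAt_id t).const_mul C)).add
      ((h.hasDerivAt_pos t ht').mul (h.hasDerivAt_mom t ht'))).congr_deriv ?_
    have h2 := energy_pos_mom hα x₀ w ht'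
    have h3 := force_mul_self hα (pos hα x₀ w t)
    rw [hC]
    linear_combination h2 - w.2 ^ 2 * h3
  have h2 := eq_of_hasDerivWithinAt_zero (convex_Icc 0 1) h1
    (by norm_num : (1 : ℝ) ∈ Icc (0 : ℝ) 1) (by norm_num : (0 : ℝ) ∈ Icc (0 : ℝ) 1)
  simp only [intervalIntegral.integral_same, pos_zero, mom_zero] at h2
  linarith

end

lemma expDomain_eq_univ {α : ℝ} (hα : 1 ≤ α) (q : ℝ × ℝ) :
    expDomain (grushinFields α) q = univ := by
  refine eq_univ_of_forall fun l => ?_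
  have h := (isTrajectory_pos_mom hα q.1 (covector.symm l)).mem_expDomain hα q.2
  rw [pos_zero, mom_zero] at h
  simpa using h

/-! ### Injective maps of the plane -/

/-- The linear automorphism of the plane with an invertible matrix `a, b; c, d`. -/
noncomputable def planeEquiv (a b c d : ℝ) (h : a * d - b * c ≠ 0) : (ℝ × ℝ) ≃L[ℝ] (ℝ × ℝ) :=
  LinearEquiv.toContinuousLinearEquiv
    { toFun := fun z => (a * z.1 + b * z.2, c * z.1 + d * z.2)
      invFun := fun z => ((d * z.1 - b * z.2) / (a * d - b * c),
        (a * z.2 - c * z.1) / (a * d - b * c))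
      map_add' := fun w z => by
        ext <;> simp <;> ring
      map_smul' := fun r w => by
        ext <;> simp <;> ring
      left_inv := fun z => by
        ext
        · show (d * (a * z.1 + b * z.2) - b * (c * z.1 + d * z.2)) / (a * d - b * c) = z.1
          rw [div_eq_iff h]
          ring
        · show (a * (c * z.1 + d * z.2) - c * (a * z.1 + b * z.2)) / (a * d - b * c) = z.2
          rw [div_eq_iff h]
          ring
      right_inv := fun z => by
        ext
        · show a * ((d * z.1 - b * z.2) / (a * d - b * c)) +
            b * ((a * z.2 - c * z.1) / (a * d - b * c)) = z.1
          rw [← mul_div_assoc, ← mul_div_assoc, ← add_div, div_eq_iff h]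
          ring
        · show c * ((d * z.1 - b * z.2) / (a * d - b * c)) +
            d * ((a * z.2 - c * z.1) / (a * d - b * c)) = z.2
          rw [← mul_div_assoc, ← mul_div_assoc, ← add_div, div_eq_iff h]
          ring }

lemma planeEquiv_apply (a b c d : ℝ) (h : a * d - b * c ≠ 0) (z : ℝ × ℝ) :
    planeEquiv a b c d h z = (a * z.1 + b * z.2, c * z.1 + d * z.2) := rfl

lemma planeEquiv_symm_apply (a b c d : ℝ) (h : a * d - b * c ≠ 0) (z : ℝ × ℝ) :
    (planeEquiv a b c d h).symm z = ((d * z.1 - b * z.2) / (a * d - b * c),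
        (a * z.2 - c * z.1) / (a * d - b * c)) := rfl

/-- A continuous function on a square that is injective on each vertical line is strictly
monotone along vertical lines, in the same direction on all of them. -/
lemma exists_sign_of_injOn_vertical {g : ℝ × ℝ → ℝ} {c : ℝ × ℝ} {ε : ℝ}
    (hg : ContinuousOn g (Metric.ball c ε))
    (hinj : ∀ x w w', (x, w) ∈ Metric.ball c ε → (x, w') ∈ Metric.ball c ε →
      g (x, w) = g (x, w') → w = w') :
    ∃ σ : ℝ, σ ≠ 0 ∧ ∀ x w w', (x, w) ∈ Metric.ball c ε → (x, w') ∈ Metric.ball c ε →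
      w < w' → 0 < σ * (g (x, w') - g (x, w)) := by
  set T : Set (ℝ × ℝ × ℝ) :=
    {z | (z.1, z.2.1) ∈ Metric.ball c ε ∧ (z.1, z.2.2) ∈ Metric.ball c ε ∧ z.2.1 < z.2.2} with hT
  have hTc : Convex ℝ T := by
    intro z hz z' hz' a b ha hb hab
    refine ⟨convex_ball c ε hz.1 hz'.1 ha hb hab, convex_ball c ε hz.2.1 hz'.2.1 ha hb hab, ?_⟩
    have h1 := hz.2.2
    have h2 := hz'.2.2
    show a * z.2.1 + b * z'.2.1 < a * z.2.2 + b * z'.2.2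
    rcases ha.eq_or_lt with rfl | ha
    · obtain rfl : b = 1 := by linarith
      linarith
    · nlinarith
  have hcont : ContinuousOn (fun z : ℝ × ℝ × ℝ => g (z.1, z.2.2) - g (z.1, z.2.1)) T :=
    (hg.comp (by fun_prop) fun z hz => hz.2.1).sub (hg.comp (by fun_prop) fun z hz => hz.1)
  have hne : ∀ z ∈ T, g (z.1, z.2.2) - g (z.1, z.2.1) ≠ 0 := fun z hz h =>
    hz.2.2.ne (hinj _ _ _ hz.1 hz.2.1 (sub_eq_zero.1 h).symm)
  have hord := (hTc.isPreconnected.image _ hcont).ordConnected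
  by_cases hpos : ∃ z ∈ T, 0 < g (z.1, z.2.2) - g (z.1, z.2.1)
  · obtain ⟨z, hz, hzpos⟩ := hpos
    refine ⟨1, one_ne_zero, fun x w w' h1 h2 h3 => ?_⟩
    rw [one_mul]
    by_contra! hle
    obtain ⟨z', hz', h0⟩ := hord.out (mem_image_of_mem _ (show (x, w, w') ∈ T from ⟨h1, h2, h3⟩))
      (mem_image_of_mem _ hz) ⟨hle, hzpos.le⟩
    exact hne z' hz' h0
  · push Not at hpos
    refine ⟨-1, by norm_num, fun x w w' h1 h2 h3 => ?_⟩
    have h := hpos (x, w, w') ⟨h1, h2, h3⟩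
    have h' := hne (x, w, w') ⟨h1, h2, h3⟩
    have := lt_of_le_of_ne h h'
    linarith

/-- The Jacobian determinant of `(a, b)` with respect to the coordinates of the plane. -/
noncomputable def jacobian (a b : ℝ × ℝ → ℝ) (z : ℝ × ℝ) : ℝ :=
  fderiv ℝ a z (1, 0) * fderiv ℝ b z (0, 1) - fderiv ℝ a z (0, 1) * fderiv ℝ b z (1, 0)

/-- The Jacobian determinant of an injective `C^1` map of the plane does not change sign near a
point where the derivative has rank at least one. Using the first component `a` as a coordinate,
the map becomes `(x, w) ↦ (x, g (x, w))`, and `g` is monotone in `w`, in a direction that does not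
depend on `x`. -/
theorem exists_sign_jacobian_of_injOn {a b : ℝ × ℝ → ℝ} {p : ℝ × ℝ}
    (ha : ContDiffAt ℝ 1 a p) (hb : ContDiffAt ℝ 1 b p) (hs : fderiv ℝ a p (1, 0) ≠ 0)
    {U : Set (ℝ × ℝ)} (hU : U ∈ 𝓝 p) (hinj : InjOn (fun z => (a z, b z)) U) :
    ∃ σ : ℝ, σ ≠ 0 ∧ ∀ᶠ z in 𝓝 p, 0 ≤ σ * jacobian a b z := by
  have hone : (1 : WithTop ℕ∞) ≠ 0 := one_ne_zero
  set Φ : ℝ × ℝ → ℝ × ℝ := fun z => (a z, z.2) with hΦ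
  have hΦc : ContDiffAt ℝ 1 Φ p := ha.prodMk contDiffAt_snd
  have hdet : fderiv ℝ a p (1, 0) * 1 - fderiv ℝ a p (0, 1) * 0 ≠ 0 := by simpa using hs
  have hexp : ∀ (L : ℝ × ℝ →L[ℝ] ℝ) (z : ℝ × ℝ), L z = L (1, 0) * z.1 + L (0, 1) * z.2 :=
    fun L z => dual_apply L z
  have hΦd : HasFDerivAt Φ ((planeEquiv _ _ 0 1 hdet : (ℝ × ℝ) ≃L[ℝ] (ℝ × ℝ)) :
      (ℝ × ℝ) →L[ℝ] (ℝ × ℝ)) p := by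
    have h := (ha.differentiableAt hone).hasFDerivAt.prodMk (hasFDerivAt_snd (𝕜 := ℝ) (p := p))
    refine h.congr_fderiv (ContinuousLinearMap.ext fun z => ?_)
    have := hexp (fderiv ℝ a p) z
    simp [planeEquiv_apply, this]
  set Ψ := hΦc.localInverse hΦd hone with hΨ
  have hΨp : Ψ (Φ p) = p := hΦc.localInverse_apply_image hΦd hone
  have hΨc : ContDiffAt ℝ 1 Ψ (Φ p) := hΦc.to_localInverse hΦd hone
  have hleft : ∀ᶠ z in 𝓝 p, Ψ (Φ z) = z :=
    (hΦc.hasStrictFDerivAt' hΦd hone).eventually_left_inverse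
  have hright : ∀ᶠ y in 𝓝 (Φ p), Φ (Ψ y) = y :=
    (hΦc.hasStrictFDerivAt' hΦd hone).eventually_right_inverse
  have hΨt : Tendsto Ψ (𝓝 (Φ p)) (𝓝 p) := by
    have := hΨc.continuousAt.tendsto
    rwa [hΨp] at this
  have had : ∀ᶠ z in 𝓝 p, DifferentiableAt ℝ a z :=
    (ha.eventually (by simp)).mono fun z h => h.differentiableAt hone
  have hbd : ∀ᶠ z in 𝓝 p, DifferentiableAt ℝ b z :=
    (hb.eventually (by simp)).mono fun z h => h.differentiableAt hone
  have hΨd : ∀ᶠ y in 𝓝 (Φ p), DifferentiableAt ℝ Ψ y :=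
    (hΨc.eventually (by simp)).mono fun z h => h.differentiableAt hone
  obtain ⟨ε, hε, hball⟩ := Metric.eventually_nhds_iff_ball.1
    (hright.and (hΨd.and (hΨt.eventually ((eventually_mem_set.2 hU).and (had.and hbd)))))
  set B := Metric.ball (Φ p) ε with hB
  have hinjg : ∀ x w w', (x, w) ∈ B → (x, w') ∈ B → b (Ψ (x, w)) = b (Ψ (x, w')) → w = w' := by
    intro x w w' h h' heq
    obtain ⟨h1, -, h2, -, -⟩ := hball _ h
    obtain ⟨h1', -, h2', -, -⟩ := hball _ h'
    have h3 : a (Ψ (x, w)) = x := congrArg Prod.fst h1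
    have h3' : a (Ψ (x, w')) = x := congrArg Prod.fst h1'
    have h4 := hinj h2 h2' (Prod.ext (h3.trans h3'.symm) heq)
    rw [h4, h1'] at h1
    exact (congrArg Prod.snd h1).symm
  have hgd : ∀ y ∈ B, DifferentiableAt ℝ (fun y => b (Ψ y)) y := by
    intro y hy
    obtain ⟨-, h1, -, -, h2⟩ := hball _ hy
    exact h2.comp y h1
  obtain ⟨σ, hσ, hmono⟩ := exists_sign_of_injOn_vertical (g := fun y => b (Ψ y))
    (fun y hy => (hgd y hy).continuousAt.continuousWithinAt) hinjg
  -- the derivative of `b ∘ Ψ` along vertical lines is `jacobian a b / ∂₁ a`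
  have hderiv : ∀ y ∈ B, 0 ≤ σ * fderiv ℝ a (Ψ y) (1, 0) * jacobian a b (Ψ y) := by
    intro y hy
    obtain ⟨-, hΨy, -, hay, hby⟩ := hball _ hy
    have hline : HasDerivAt (fun w : ℝ => (y.1, w)) (0, 1) y.2 :=
      (hasDerivAt_const _ _).prodMk (hasDerivAt_id _)
    have hΨl : HasDerivAt (fun w : ℝ => Ψ (y.1, w)) (fderiv ℝ Ψ y (0, 1)) y.2 :=
      HasFDerivAt.comp_hasDerivAt (l := Ψ) y.2 hΨy.hasFDerivAt hline
    set s := (fderiv ℝ Ψ y (0, 1)).1 with hsdef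
    have hBl : ∀ᶠ w in 𝓝 y.2, (y.1, w) ∈ B :=
      hline.continuousAt.eventually (Metric.isOpen_ball.mem_nhds hy)
    have hsnd : (fderiv ℝ Ψ y (0, 1)).2 = 1 := by
      have h1 : HasDerivAt (fun w : ℝ => (Ψ (y.1, w)).2) (fderiv ℝ Ψ y (0, 1)).2 y.2 := hΨl.snd
      refine (h1.congr_of_eventuallyEq ?_).unique (hasDerivAt_id y.2)
      filter_upwards [hBl] with w hw
      exact (congrArg Prod.snd (hball _ hw).1).symm
    have h01 : fderiv ℝ Ψ y (0, 1) = (s, 1) := Prod.ext rfl hsnd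
    have hfst : fderiv ℝ a (Ψ y) (1, 0) * s + fderiv ℝ a (Ψ y) (0, 1) = 0 := by
      have h1 : HasDerivAt (fun w : ℝ => a (Ψ (y.1, w)))
          (fderiv ℝ a (Ψ y) (fderiv ℝ Ψ y (0, 1))) y.2 :=
        HasFDerivAt.comp_hasDerivAt (l := a) y.2 hay.hasFDerivAt hΨl
      have h2 := (h1.congr_of_eventuallyEq (f₁ := fun _ => y.1) ?_).unique (hasDerivAt_const _ _)
      · rw [h01, hexp] at h2
        simpa using h2
      · filter_upwards [hBl] with w hw
        exact (congrArg Prod.fst (hball _ hw).1).symm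
    have hg : HasDerivAt (fun w : ℝ => b (Ψ (y.1, w)))
        (fderiv ℝ b (Ψ y) (fderiv ℝ Ψ y (0, 1))) y.2 :=
      HasFDerivAt.comp_hasDerivAt (l := b) y.2 hby.hasFDerivAt hΨl
    rw [h01, hexp] at hg
    have hnn : 0 ≤ σ * (fderiv ℝ b (Ψ y) (1, 0) * s + fderiv ℝ b (Ψ y) (0, 1)) := by
      refine (ge_of_tendsto (hasDerivAt_iff_tendsto_slope.1 (hg.const_mul σ)) ?_).trans_eq ?_
      · filter_upwards [nhdsWithin_le_nhds hBl, self_mem_nhdsWithin] with w hw hne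
        rw [slope_def_field]
        rcases lt_or_gt_of_ne (hne : w ≠ y.2) with h | h
        · refine div_nonneg_of_nonpos ?_ (by linarith)
          have := hmono y.1 w y.2 hw hy h
          linarith
        · refine div_nonneg ?_ (by linarith)
          have := hmono y.1 y.2 w hy hw h
          linarith
      · simp
    have hid : σ * fderiv ℝ a (Ψ y) (1, 0) * jacobian a b (Ψ y) = (fderiv ℝ a (Ψ y) (1, 0)) ^ 2 *
        (σ * (fderiv ℝ b (Ψ y) (1, 0) * s + fderiv ℝ b (Ψ y) (0, 1))) := by
      rw [jacobian]
      linear_combination -(σ * fderiv ℝ a (Ψ y) (1, 0) * fderiv ℝ b (Ψ y) (1, 0)) * hfst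
    rw [hid]
    positivity
  refine ⟨σ * fderiv ℝ a p (1, 0), mul_ne_zero hσ hs, ?_⟩
  have hcd : ContinuousAt (fun z => fderiv ℝ a z (1, 0)) p :=
    (ha.fderiv_right (m := 0) (by simp)).continuousAt.clm_apply continuousAt_const
  have hsgn : ∀ᶠ z in 𝓝 p, 0 < fderiv ℝ a p (1, 0) * fderiv ℝ a z (1, 0) :=
    (continuousAt_const.mul hcd).eventually (lt_mem_nhds (mul_self_pos.2 hs))
  have hΦB : ∀ᶠ z in 𝓝 p, Φ z ∈ B :=
    hΦc.continuousAt.eventually (Metric.ball_mem_nhds _ hε)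
  filter_upwards [hleft, hsgn, hΦB] with z h1 h2 h3
  have h4 := hderiv _ h3
  rw [h1] at h4
  have h5 : 0 < (fderiv ℝ a z (1, 0)) ^ 2 := by
    have : fderiv ℝ a z (1, 0) ≠ 0 := fun h => by simp [h] at h2
    positivity
  refine (mul_nonneg_iff_of_pos_left h5).1 ?_
  have h6 : (fderiv ℝ a z (1, 0)) ^ 2 * (σ * fderiv ℝ a p (1, 0) * jacobian a b z) =
      (fderiv ℝ a p (1, 0) * fderiv ℝ a z (1, 0)) *
        (σ * fderiv ℝ a z (1, 0) * jacobian a b z) := by ring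
  rw [h6]
  exact mul_nonneg h2.le h4

/-! ### Differentiability of the end point -/

/-- Twice the energy of the normal extremal from `x₀` with initial covector `w`. -/
noncomputable def energy (α x₀ : ℝ) (w : ℝ × ℝ) : ℝ := w.1 ^ 2 + w.2 ^ 2 * |x₀| ^ (2 * α)

lemma energy_pos {α x₀ : ℝ} {w : ℝ × ℝ} (h : (x₀, w.1) ≠ 0) (hw : w.2 ≠ 0) :
    0 < energy α x₀ w := by
  rw [energy]
  rcases eq_or_ne w.1 0 with h1 | h1
  · have hx : x₀ ≠ 0 := fun hx => h (by rw [hx, h1]; rfl)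
    have : 0 < |x₀| ^ (2 * α) := Real.rpow_pos_of_pos (abs_pos.2 hx) _
    positivity
  · have : 0 ≤ w.2 ^ 2 * |x₀| ^ (2 * α) := by positivity
    positivity

section

variable {α : ℝ} (hα : 1 ≤ α) (x₀ : ℝ) (w : ℝ × ℝ)

lemma hasStrictDerivAt_pos {t : ℝ} (ht : t ∈ Ioo (-2 : ℝ) 2) :
    HasStrictDerivAt (pos hα x₀ w) (mom hα x₀ w t) t := by
  have h := isTrajectory_pos_mom hα x₀ w
  exact hasStrictDerivAt_of_hasDerivAt_of_continuousAt
    (eventually_of_mem (isOpen_Ioo.mem_nhds ht) h.hasDerivAt_pos)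
    (h.hasDerivAt_mom t ht).continuousAt

lemma hasStrictDerivAt_mom {t : ℝ} (ht : t ∈ Ioo (-2 : ℝ) 2) :
    HasStrictDerivAt (mom hα x₀ w) (-(w.2 ^ 2 * force α (pos hα x₀ w t))) t := by
  have h := isTrajectory_pos_mom hα x₀ w
  exact hasStrictDerivAt_of_hasDerivAt_of_continuousAt
    (eventually_of_mem (isOpen_Ioo.mem_nhds ht) h.hasDerivAt_mom)
    (((continuous_force hα).continuousAt.comp
      (h.hasDerivAt_pos t ht).continuousAt).const_mul _).neg

/-- The derivative of `w ↦ (pos hα x₀ w 1, mom hα x₀ w 1)` in the direction `(1, 0)`. -/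
noncomputable def endDerivFst : ℝ × ℝ :=
  ((pos hα x₀ w 1 * w.1 + mom hα x₀ w 1 * ((α - 1) * w.1 - x₀)) / (α * energy α x₀ w),
    (α * mom hα x₀ w 1 * w.1 -
      w.2 ^ 2 * force α (pos hα x₀ w 1) * ((α - 1) * w.1 - x₀)) / (α * energy α x₀ w))

/-- The derivative of `w ↦ (pos hα x₀ w 1, mom hα x₀ w 1)` in the radial direction `w`. -/
noncomputable def endDerivRadial : ℝ × ℝ :=
  (mom hα x₀ w 1, mom hα x₀ w 1 - w.2 ^ 2 * force α (pos hα x₀ w 1))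

/-- The derivative of `w ↦ (pos hα x₀ w 1, mom hα x₀ w 1)` at a covector with `w.2 ≠ 0`, determined
by its values on `w` and `(1, 0)`. -/
noncomputable def endDeriv : (ℝ × ℝ) →L[ℝ] (ℝ × ℝ) :=
  (ContinuousLinearMap.fst ℝ ℝ ℝ).smulRight (endDerivFst hα x₀ w) +
    (ContinuousLinearMap.snd ℝ ℝ ℝ).smulRight
      (w.2⁻¹ • (endDerivRadial hα x₀ w - w.1 • endDerivFst hα x₀ w))

/-- Solutions with initial covectors close to `w` are obtained from the one with initial covector
`w` by the dilation `x ↦ l * x` and the affine change of time `t ↦ m * t + s`. The parameters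
depend differentiably on the covector, by the inverse function theorem. -/
theorem hasFDerivAt_end (hw : w.2 ≠ 0) (hE : energy α x₀ w ≠ 0) :
    HasFDerivAt (fun z => (pos hα x₀ z 1, mom hα x₀ z 1)) (endDeriv hα x₀ w) w := by
  set x := pos hα x₀ w with hx
  set p := mom hα x₀ w with hp
  have htraj : IsTrajectory α w.2 x p := isTrajectory_pos_mom hα x₀ w
  have hx0 : x 0 = x₀ := pos_zero hα x₀ w
  have hp0 : p 0 = w.1 := mom_zero hα x₀ w
  have hα0 : α ≠ 0 := by linarith
  -- `Ψ (l, s)` are the initial data of the solution dilated by `l` and translated by `s`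
  set Ψ : ℝ × ℝ → ℝ × ℝ := fun z => (z.1 * x z.2, z.1 ^ α * p z.2) with hΨ
  have hΨ1 : Ψ (1, 0) = (x₀, w.1) := by simp [hΨ, hx0, hp0]
  have hdet : x₀ * (-(w.2 ^ 2 * force α x₀)) - w.1 * (α * w.1) = -(α * energy α x₀ w) := by
    have := force_mul_self hα x₀
    rw [energy]
    linear_combination -w.2 ^ 2 * this
  have hdet0 : x₀ * (-(w.2 ^ 2 * force α x₀)) - w.1 * (α * w.1) ≠ 0 := by
    rw [hdet]
    exact neg_ne_zero.2 (mul_ne_zero hα0 hE)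
  have hzero : (0 : ℝ) ∈ Ioo (-2 : ℝ) 2 := by norm_num
  have hΨd : HasStrictFDerivAt Ψ ((planeEquiv x₀ w.1 (α * w.1) (-(w.2 ^ 2 * force α x₀)) hdet0 :
      (ℝ × ℝ) ≃L[ℝ] (ℝ × ℝ)) : (ℝ × ℝ) →L[ℝ] (ℝ × ℝ)) (1, 0) := by
    have h1 : HasStrictFDerivAt (fun z : ℝ × ℝ => z.1) (ContinuousLinearMap.fst ℝ ℝ ℝ) (1, 0) :=
      hasStrictFDerivAt_fst
    have h2 : HasStrictFDerivAt (fun z : ℝ × ℝ => z.2) (ContinuousLinearMap.snd ℝ ℝ ℝ)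
      ((1 : ℝ), (0 : ℝ)) := hasStrictFDerivAt_snd
    have h3 := (hasStrictDerivAt_pos hα x₀ w hzero).comp_hasStrictFDerivAt ((1 : ℝ), (0 : ℝ)) h2
    have h4 := (hasStrictDerivAt_mom hα x₀ w hzero).comp_hasStrictFDerivAt ((1 : ℝ), (0 : ℝ)) h2
    have h5 := (Real.hasStrictDerivAt_rpow_const (x := 1) (p := α)
      (Or.inl one_ne_zero)).comp_hasStrictFDerivAt ((1 : ℝ), (0 : ℝ)) h1
    refine ((h1.mul h3).prodMk (h5.mul h4)).congr_fderiv (ContinuousLinearMap.ext fun z => ?_)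
    ext
    · simp [planeEquiv_apply, pos_zero, mom_zero]
      ring
    · simp [planeEquiv_apply, pos_zero, mom_zero]
      ring
  set Λ : ℝ × ℝ → ℝ × ℝ := hΨd.localInverse Ψ _ _ with hΛ
  have hΛ1 : Λ (x₀, w.1) = (1, 0) := by
    rw [← hΨ1]
    exact hΨd.localInverse_apply_image
  have hΛd : HasFDerivAt Λ ((planeEquiv x₀ w.1 (α * w.1) (-(w.2 ^ 2 * force α x₀)) hdet0).symm :
      (ℝ × ℝ) →L[ℝ] (ℝ × ℝ)) (x₀, w.1) := by
    rw [← hΨ1]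
    exact hΨd.to_localInverse.hasFDerivAt
  have hΛr : ∀ᶠ y in 𝓝 (x₀, w.1), Ψ (Λ y) = y := by
    rw [← hΨ1]
    exact hΨd.eventually_right_inverse
  -- initial data of the solution to be rescaled, with the second covector component kept at `w.2`
  set ini : ℝ × ℝ → ℝ × ℝ := fun z => (x₀, z.1 * w.2 * z.2⁻¹) with hini
  have hiniw : ini w = (x₀, w.1) := by simp [hini, hw]
  have hfst : HasFDerivAt (fun z : ℝ × ℝ => z.1) (ContinuousLinearMap.fst ℝ ℝ ℝ) w :=
    hasFDerivAt_fst
  have hsnd : HasFDerivAt (fun z : ℝ × ℝ => z.2) (ContinuousLinearMap.snd ℝ ℝ ℝ) w :=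
    hasFDerivAt_snd
  have hinid := (hasFDerivAt_const x₀ w).prodMk 
    ((hfst.mul_const w.2).mul ((hasDerivAt_inv hw).comp_hasFDerivAt w hsnd))
  have hpar : HasFDerivAt (fun z => Λ (ini z)) _ w :=
    HasFDerivAt.comp (g := Λ) w (hiniw ▸ hΛd) hinid
  have hparw : Λ (ini w) = (1, 0) := by rw [hiniw, hΛ1]
  set δ : (ℝ × ℝ) →L[ℝ] ℝ :=
    ContinuousLinearMap.fst ℝ ℝ ℝ - (w.1 / w.2) • ContinuousLinearMap.snd ℝ ℝ ℝ with hδ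
  set l : ℝ × ℝ → ℝ := fun z => (Λ (ini z)).1 with hldef
  set s : ℝ × ℝ → ℝ := fun z => (Λ (ini z)).2 with hsdef
  have hlw : l w = 1 := by simp [hldef, hparw]
  have hsw : s w = 0 := by simp [hsdef, hparw]
  have hsymm : ∀ r, (planeEquiv x₀ w.1 (α * w.1) (-(w.2 ^ 2 * force α x₀)) hdet0).symm (0, r) =
      (w.1 / (α * energy α x₀ w) * r, -x₀ / (α * energy α x₀ w) * r) := by
    intro r
    rw [planeEquiv_symm_apply, hdet]
    ext <;> simp <;> field_simp
  have hl : HasFDerivAt l ((w.1 / (α * energy α x₀ w)) • δ) w := by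
    refine hpar.fst.congr_fderiv (ContinuousLinearMap.ext fun z => ?_)
    change ((planeEquiv _ _ _ _ hdet0).symm (0, _)).1 = _
    rw [hsymm]
    simp [hδ]
    field_simp
    ring_nf
    simp
  have hs : HasFDerivAt s ((-x₀ / (α * energy α x₀ w)) • δ) w := by
    refine hpar.snd.congr_fderiv (ContinuousLinearMap.ext fun z => ?_)
    change ((planeEquiv _ _ _ _ hdet0).symm (0, _)).2 = _
    rw [hsymm]
    simp [hδ]
    field_simp
    ring_nf
    simp
  set m : ℝ × ℝ → ℝ := fun z => z.2 * w.2⁻¹ * l z ^ (α - 1) with hmdef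
  have hmw : m w = 1 := by simp [hmdef, hlw, hw]
  have hm : HasFDerivAt m (w.2⁻¹ • ContinuousLinearMap.snd ℝ ℝ ℝ +
      ((α - 1) * (w.1 / (α * energy α x₀ w))) • δ) w := by
    have h := (hsnd.mul_const w.2⁻¹).mul
      (hl.rpow_const (p := α - 1) (Or.inl (by rw [hlw]; exact one_ne_zero)))
    refine h.congr_fderiv (ContinuousLinearMap.ext fun z => ?_)
    simp [hlw]
    field_simp
    ring
  have hone : (1 : ℝ) ∈ Ioo (-2 : ℝ) 2 := by norm_num
  have hms1 : m w + s w = 1 := by rw [hmw, hsw, add_zero]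
  have hxe : HasFDerivAt (fun z => x (m z + s z)) _ w :=
    HasDerivAt.comp_hasFDerivAt w (h₂ := x) (by rw [hms1]; exact htraj.hasDerivAt_pos 1 hone)
      (hm.add hs)
  have hpe : HasFDerivAt (fun z => p (m z + s z)) _ w :=
    HasDerivAt.comp_hasFDerivAt w (h₂ := p) (by rw [hms1]; exact htraj.hasDerivAt_mom 1 hone)
      (hm.add hs)
  have hD := (hl.mul hxe).prodMk ((hl.mul hm).mul hpe)
  -- the rescaled solution
  have hev : (fun z => (pos hα x₀ z 1, mom hα x₀ z 1)) =ᶠ[𝓝 w]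
      fun z => (l z * x (m z + s z), l z * m z * p (m z + s z)) := by
    have e1 : ∀ᶠ z in 𝓝 w, Ψ (Λ (ini z)) = ini z := by
      have : ContinuousAt ini w := hinid.continuousAt
      exact this.tendsto.eventually (by rw [hiniw]; exact hΛr)
    have e2 : ∀ᶠ z in 𝓝 w, 0 < l z :=
      hl.continuousAt.eventually (lt_mem_nhds (by rw [hlw]; exact one_pos))
    have e3 : ∀ᶠ z in 𝓝 w, s z ∈ Ioo (-(1 / 4) : ℝ) (1 / 4) :=
      hs.continuousAt.eventually (isOpen_Ioo.mem_nhds (by rw [hsw]; norm_num))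
    have e4 : ∀ᶠ z in 𝓝 w, m z ∈ Ioo (0 : ℝ) (3 / 2) :=
      hm.continuousAt.eventually (isOpen_Ioo.mem_nhds (by rw [hmw]; norm_num))
    have e5 : ∀ᶠ z in 𝓝 w, z.2 ≠ 0 := hsnd.continuousAt.eventually (isOpen_ne.mem_nhds hw)
    filter_upwards [e1, e2, e3, e4, e5] with z h1 h2 h3 h4 h5
    have i1 : l z * x (s z) = x₀ := congrArg Prod.fst h1
    have i2 : l z ^ α * p (s z) = z.1 * w.2 * z.2⁻¹ := congrArg Prod.snd h1
    have hmem : ∀ t ∈ Icc (0 : ℝ) 1, m z * t + s z ∈ Ioo (-2 : ℝ) 2 := by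
      intro t ht
      have k1 : 0 ≤ m z * t := mul_nonneg h4.1.le ht.1
      have k2 : m z * t ≤ m z * 1 := mul_le_mul_of_nonneg_left ht.2 h4.1.le
      constructor <;> linarith [h3.1, h3.2, h4.2]
    have htime : ∀ t : ℝ, HasDerivAt (fun t => m z * t + s z) (m z) t := fun t => by
      simpa using ((hasDerivAt_id t).const_mul (m z)).add_const (s z)
    have hlpow : l z * m z = z.2 / w.2 * l z ^ α := by
      have : l z ^ α = l z ^ (α - 1) * l z := by
        rw [← Real.rpow_add_one h2.ne']
        ring_nf
      rw [this, hmdef]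
      ring
    have hsc : m z ^ 2 * w.2 ^ 2 * l z = z.2 ^ 2 * l z ^ (2 * α - 1) := by
      have : l z ^ (2 * α - 1) = l z ^ (α - 1) * l z ^ (α - 1) * l z := by
        rw [← Real.rpow_add h2, ← Real.rpow_add_one h2.ne']
        ring_nf
      rw [this, hmdef]
      field_simp
    have key := pos_mom_eq hα x₀ z (x := fun t => l z * x (m z * t + s z))
      (p := fun t => l z * m z * p (m z * t + s z))
      (fun t ht => by
        have := ((htraj.hasDerivAt_pos _ (hmem t ht)).comp t (htime t)).const_mul (l z)
        exact this.congr_deriv (by ring))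
      (fun t ht => by
        have := ((htraj.hasDerivAt_mom _ (hmem t ht)).comp t (htime t)).const_mul (l z * m z)
        refine this.congr_deriv ?_
        rw [force_mul_left h2]
        linear_combination -force α (x (m z * t + s z)) * hsc)
      (by simp [i1])
      (by
        simp only [mul_zero, zero_add]
        rw [hlpow, mul_assoc, i2]
        field_simp)
      (t := 1) (by norm_num)
    simp only [mul_one] at key
    exact Prod.ext key.1 key.2
  refine (hD.congr_of_eventuallyEq hev).congr_fderiv ?_
  refine ContinuousLinearMap.ext fun z => ?_
  ext
  · simp [endDeriv, endDerivFst, endDerivRadial, hlw, hmw, hsw, hδ, ← hx, ← hp]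
    field_simp
    ring
  · simp [endDeriv, endDerivFst, endDerivRadial, hlw, hmw, hsw, hδ, ← hx, ← hp]
    field_simp
    ring

end

/-! ### The Jacobian determinant -/

section

variable {α : ℝ} (hα : 1 ≤ α) (x₀ : ℝ) (w : ℝ × ℝ)

lemma endDeriv_fst : endDeriv hα x₀ w (1, 0) = endDerivFst hα x₀ w := by
  simp [endDeriv]

lemma endDeriv_radial (hw : w.2 ≠ 0) : endDeriv hα x₀ w w = endDerivRadial hα x₀ w := by
  simp [endDeriv, smul_smul, hw]

lemma continuous_energy : Continuous (energy α x₀) := by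
  unfold energy
  fun_prop

lemma contDiffAt_end (hw : w.2 ≠ 0) (hE : energy α x₀ w ≠ 0) :
    ContDiffAt ℝ 1 (fun z => (pos hα x₀ z 1, mom hα x₀ z 1)) w := by
  rw [contDiffAt_one_iff]
  have hcE : Continuous (energy α x₀) := continuous_energy x₀
  have hopen : IsOpen {z : ℝ × ℝ | z.2 ≠ 0 ∧ energy α x₀ z ≠ 0} :=
    (isOpen_ne.preimage continuous_snd).inter (isOpen_ne.preimage hcE)
  refine ⟨endDeriv hα x₀, _, hopen.mem_nhds ⟨hw, hE⟩, ?_, fun z hz =>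
    hasFDerivAt_end hα x₀ z hz.1 hz.2⟩
  intro z hz
  refine ContinuousAt.continuousWithinAt ?_
  have hend := (hasFDerivAt_end hα x₀ z hz.1 hz.2).continuousAt
  have hpos : ContinuousAt (fun z => pos hα x₀ z 1) z := continuousAt_fst.comp hend
  have hmom : ContinuousAt (fun z => mom hα x₀ z 1) z := continuousAt_snd.comp hend
  have hforce : ContinuousAt (fun z => force α (pos hα x₀ z 1)) z :=
    (continuous_force hα).continuousAt.comp hpos
  have h1 : ContinuousAt (fun z : ℝ × ℝ => z.1) z := continuousAt_fst
  have h2 : ContinuousAt (fun z : ℝ × ℝ => z.2) z := continuousAt_snd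
  have hden : α * energy α x₀ z ≠ 0 := mul_ne_zero (by linarith) hz.2
  have hdenc : ContinuousAt (fun z => α * energy α x₀ z) z := hcE.continuousAt.const_mul α
  have h3 : ContinuousAt (fun z : ℝ × ℝ => (α - 1) * z.1 - x₀) z :=
    (h1.const_mul _).sub continuousAt_const
  have hF : ContinuousAt (endDerivFst hα x₀) z :=
    (((hpos.mul h1).add (hmom.mul h3)).div hdenc hden).prodMk
      ((((hmom.const_mul α).mul h1).sub (((h2.pow 2).mul hforce).mul h3)).div hdenc hden)
  have hR : ContinuousAt (endDerivRadial hα x₀) z :=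
    hmom.prodMk (hmom.sub ((h2.pow 2).mul hforce))
  have hL : ∀ (c : (ℝ × ℝ) →L[ℝ] ℝ) {f : ℝ × ℝ → ℝ × ℝ}, ContinuousAt f z →
      ContinuousAt (fun z => c.smulRight (f z)) z := fun c f hf =>
    (ContinuousLinearMap.smulRightL ℝ (ℝ × ℝ) (ℝ × ℝ) c).continuous.continuousAt.comp hf
  exact (hL _ hF).add (hL _ ((h2.inv₀ hz.1).smul (hR.sub (h1.smul hF))))

/-- The vertical displacement along the normal extremal, for covectors with `w.2 ≠ 0`. -/
noncomputable def vert : ℝ :=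
  (energy α x₀ w - pos hα x₀ w 1 * mom hα x₀ w 1 + x₀ * w.1) / ((1 + α) * w.2)

lemma expMap_covector_of_ne_zero (y₀ : ℝ) (hw : w.2 ≠ 0) :
    expMap (grushinFields α) (x₀, y₀) (covector w) = (pos hα x₀ w 1, y₀ + vert hα x₀ w) := by
  rw [expMap_covector hα]
  have h := integral_abs_pos_rpow hα x₀ w
  have h1 : 1 + α ≠ 0 := by linarith
  rw [vert, energy, ← h]
  congr 2
  field_simp

lemma contDiffAt_pos (hw : w.2 ≠ 0) (hE : energy α x₀ w ≠ 0) :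
    ContDiffAt ℝ 1 (fun z => pos hα x₀ z 1) w :=
  (contDiffAt_end hα x₀ w hw hE).fst

lemma contDiffAt_vert (hw : w.2 ≠ 0) (hE : energy α x₀ w ≠ 0) :
    ContDiffAt ℝ 1 (vert hα x₀) w := by
  have h1 : ContDiffAt ℝ 1 (fun z => pos hα x₀ z 1) w := (contDiffAt_end hα x₀ w hw hE).fst
  have h2 : ContDiffAt ℝ 1 (fun z => mom hα x₀ z 1) w := (contDiffAt_end hα x₀ w hw hE).snd
  have h3 : ContDiffAt ℝ 1 (energy α x₀) w := by
    unfold energy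
    fun_prop
  have h4 : (1 + α) * w.2 ≠ 0 := mul_ne_zero (by linarith) hw
  exact ((h3.sub (h1.mul h2)).add (contDiffAt_const.mul contDiffAt_fst)).div
    (contDiffAt_const.mul contDiffAt_snd) h4

lemma hasFDerivAt_pos (hw : w.2 ≠ 0) (hE : energy α x₀ w ≠ 0) :
    HasFDerivAt (fun z => pos hα x₀ z 1)
      ((ContinuousLinearMap.fst ℝ ℝ ℝ).comp (endDeriv hα x₀ w)) w :=
  (hasFDerivAt_end hα x₀ w hw hE).fst

lemma fderiv_pos_fst (hw : w.2 ≠ 0) (hE : energy α x₀ w ≠ 0) :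
    fderiv ℝ (fun z => pos hα x₀ z 1) w (1, 0) = (endDerivFst hα x₀ w).1 := by
  rw [(hasFDerivAt_pos hα x₀ w hw hE).fderiv, ← endDeriv_fst]
  rfl

lemma fderiv_pos_radial (hw : w.2 ≠ 0) (hE : energy α x₀ w ≠ 0) :
    fderiv ℝ (fun z => pos hα x₀ z 1) w w = mom hα x₀ w 1 := by
  rw [(hasFDerivAt_pos hα x₀ w hw hE).fderiv]
  change (endDeriv hα x₀ w w).1 = _
  rw [endDeriv_radial hα x₀ w hw]
  rfl

lemma hasFDerivAt_vert (hw : w.2 ≠ 0) (hE : energy α x₀ w ≠ 0) :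
    ∃ D : (ℝ × ℝ) →L[ℝ] ℝ, HasFDerivAt (vert hα x₀) D w ∧ ∀ h, D h =
      (2 * w.1 * h.1 + 2 * w.2 * |x₀| ^ (2 * α) * h.2 - mom hα x₀ w 1 * (endDeriv hα x₀ w h).1 -
        pos hα x₀ w 1 * (endDeriv hα x₀ w h).2 + x₀ * h.1) / ((1 + α) * w.2) -
        vert hα x₀ w * h.2 / w.2 := by
  have h0 := hasFDerivAt_end hα x₀ w hw hE
  have h1 : HasFDerivAt (fun z => pos hα x₀ z 1) _ w := h0.fst
  have h2 : HasFDerivAt (fun z => mom hα x₀ z 1) _ w := h0.snd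
  have hfst : HasFDerivAt (fun z : ℝ × ℝ => z.1) (ContinuousLinearMap.fst ℝ ℝ ℝ) w :=
    hasFDerivAt_fst
  have hsnd : HasFDerivAt (fun z : ℝ × ℝ => z.2) (ContinuousLinearMap.snd ℝ ℝ ℝ) w :=
    hasFDerivAt_snd
  have hα1 : 1 + α ≠ 0 := by linarith
  have h3 := (((hfst.pow 2).add ((hsnd.pow 2).mul_const (|x₀| ^ (2 * α)))).sub (h1.mul h2)).add
    (hfst.const_mul x₀)
  have h4 := (hasDerivAt_inv (mul_ne_zero hα1 hw)).comp_hasFDerivAt w (hsnd.const_mul (1 + α))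
  refine ⟨_, h3.mul h4, fun h => ?_⟩
  simp [vert, energy]
  field_simp
  ring

lemma fderiv_vert_fst (hw : w.2 ≠ 0) (hE : energy α x₀ w ≠ 0) :
    fderiv ℝ (vert hα x₀) w (1, 0) =
      (2 * w.1 - mom hα x₀ w 1 * (endDerivFst hα x₀ w).1 -
        pos hα x₀ w 1 * (endDerivFst hα x₀ w).2 + x₀) / ((1 + α) * w.2) := by
  obtain ⟨D, hD, hDh⟩ := hasFDerivAt_vert hα x₀ w hw hE
  rw [hD.fderiv, hDh, endDeriv_fst]
  simp

lemma energy_end : mom hα x₀ w 1 ^ 2 + w.2 ^ 2 * |pos hα x₀ w 1| ^ (2 * α) = energy α x₀ w :=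
  energy_pos_mom hα x₀ w (by norm_num)

lemma fderiv_vert_radial (hw : w.2 ≠ 0) (hE : energy α x₀ w ≠ 0) :
    fderiv ℝ (vert hα x₀) w w = w.2 * |pos hα x₀ w 1| ^ (2 * α) := by
  obtain ⟨D, hD, hDh⟩ := hasFDerivAt_vert hα x₀ w hw hE
  have hα1 : 1 + α ≠ 0 := by linarith
  have h1 := energy_end hα x₀ w
  have h2 := force_mul_self hα (pos hα x₀ w 1)
  rw [hD.fderiv, hDh, endDeriv_radial hα x₀ w hw, vert, endDerivRadial]
  rw [energy] at h1 ⊢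
  field_simp
  linear_combination w.2 ^ 2 * h2 - h1

/-- Up to a nonzero factor, the Jacobian determinant of the exponential map at the covector `t • w`,
as a function of `t`. Its zeros are the conjugate times of the normal extremal. -/
noncomputable def conj (t : ℝ) : ℝ := (w.1 * t + x₀) * mom hα x₀ w t - w.1 * pos hα x₀ w t

lemma det_eq_conj (hw : w.2 ≠ 0) (hE : energy α x₀ w ≠ 0) :
    fderiv ℝ (fun z => pos hα x₀ z 1) w w * fderiv ℝ (vert hα x₀) w (1, 0) -
      fderiv ℝ (fun z => pos hα x₀ z 1) w (1, 0) * fderiv ℝ (vert hα x₀) w w =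
      conj hα x₀ w 1 / (α * w.2) := by
  rw [fderiv_pos_radial hα x₀ w hw hE, fderiv_pos_fst hα x₀ w hw hE,
    fderiv_vert_radial hα x₀ w hw hE, fderiv_vert_fst hα x₀ w hw hE, endDerivFst, conj]
  have hα0 : α ≠ 0 := by linarith
  have hα1 : 1 + α ≠ 0 := by linarith
  have h1 := energy_end hα x₀ w
  have h2 := force_mul_self hα (pos hα x₀ w 1)
  field_simp
  -- `h2` removes the force and `h1` the power of `|pos|`
  linear_combination mom hα x₀ w 1 * ((α - 1) * w.1 - x₀) * w.2 ^ 2 * h2 +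
    (α * mom hα x₀ w 1 * ((α - 1) * w.1 - x₀) - (1 + α) * (pos hα x₀ w 1 * w.1 +
      mom hα x₀ w 1 * ((α - 1) * w.1 - x₀))) * h1

end

/-! ### Change of sign along rays -/

/-- A function vanishing at `a` whose derivative has a strict constant sign on a punctured
neighbourhood of `a` changes sign at `a`. -/
lemma not_eventually_nonneg_of_deriv_sign {N N' : ℝ → ℝ} {a c : ℝ}
    (hN : ∀ᶠ t in 𝓝 a, HasDerivAt N (N' t) t) (hc : ∀ᶠ t in 𝓝[≠] a, 0 < c * N' t) (h0 : N a = 0)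
    {σ : ℝ} (hσ : σ ≠ 0) : ¬ ∀ᶠ t in 𝓝 a, 0 ≤ σ * N t := by
  intro h
  obtain ⟨ε, hε, hball⟩ := Metric.eventually_nhds_iff_ball.1
    (hN.and ((eventually_nhdsWithin_iff.1 hc).and h))
  simp only [Real.ball_eq_Ioo] at hball
  have hmono : ∀ r s, a - ε < r → s < a + ε → r < s → (a ≤ r ∨ s ≤ a) → c * N r < c * N s := by
    intro r s hr hs hrs has
    have hsub : ∀ t ∈ Icc r s, t ∈ Ioo (a - ε) (a + ε) := fun t ht =>
      ⟨hr.trans_le ht.1, ht.2.trans_lt hs⟩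
    refine strictMonoOn_of_deriv_pos (f := fun t => c * N t) (convex_Icc r s) (fun t ht => ?_)
      (fun t ht => ?_) (left_mem_Icc.2 hrs.le) (right_mem_Icc.2 hrs.le) hrs
    · exact ((hball t (hsub t ht)).1.const_mul c).continuousAt.continuousWithinAt
    · rw [interior_Icc] at ht
      obtain ⟨h1, h2, -⟩ := hball t (hsub t (Ioo_subset_Icc_self ht))
      rw [(h1.const_mul c).deriv]
      refine h2 fun hta => ?_
      have hta : t = a := hta
      rcases has with has | has
      · linarith [ht.1]
      · linarith [ht.2]
  have hr := hmono a (a + ε / 2) (by linarith) (by linarith) (by linarith) (Or.inl le_rfl)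
  have hl := hmono (a - ε / 2) a (by linarith) (by linarith) (by linarith) (Or.inr le_rfl)
  rw [h0, mul_zero] at hr hl
  have hr' := (hball (a + ε / 2) ⟨by linarith, by linarith⟩).2.2
  have hl' := (hball (a - ε / 2) ⟨by linarith, by linarith⟩).2.2
  rcases lt_or_gt_of_ne hσ with hs | hs
  · have h1 : N (a + ε / 2) ≤ 0 := by nlinarith
    have h2 : N (a - ε / 2) ≤ 0 := by nlinarith
    have h3 : c < 0 := by
      by_contra! h3
      nlinarith
    nlinarith
  · have h1 : 0 ≤ N (a + ε / 2) := by nlinarith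
    have h2 : 0 ≤ N (a - ε / 2) := by nlinarith
    have h3 : 0 < c := by
      by_contra! h3
      nlinarith
    nlinarith

/-- Conjugacy of a covector, read in the coordinates of `covector`. -/
lemma exists_ne_zero_of_ker_ne_bot {f : StrongDual ℝ (ℝ × ℝ) → ℝ × ℝ} {w : ℝ × ℝ}
    {L : (ℝ × ℝ) →L[ℝ] (ℝ × ℝ)} (hL : HasFDerivAt (fun z => f (covector z)) L w)
    (hker : LinearMap.ker (fderiv ℝ f (covector w)).toLinearMap ≠ ⊥) : ∃ h, h ≠ 0 ∧ L h = 0 := by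
  have hcomp : L = (fderiv ℝ f (covector w)).comp
      (covector : (ℝ × ℝ) →L[ℝ] StrongDual ℝ (ℝ × ℝ)) :=
    hL.fderiv.symm.trans (covector.comp_right_fderiv (f := f) (x := w))
  obtain ⟨l, hl, hl0⟩ := (Submodule.ne_bot_iff _).1 hker
  refine ⟨covector.symm l, by simpa using hl0, ?_⟩
  rw [hcomp, ContinuousLinearMap.comp_apply, ContinuousLinearEquiv.coe_coe,
    covector.apply_symm_apply]
  exact hl

section

variable {α : ℝ} (hα : 1 ≤ α) (x₀ : ℝ) (w : ℝ × ℝ)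

lemma hasDerivAt_conj {t : ℝ} (ht : t ∈ Ioo (-2 : ℝ) 2) :
    HasDerivAt (conj hα x₀ w) (-(w.2 ^ 2) * ((w.1 * t + x₀) * force α (pos hα x₀ w t))) t := by
  have h := isTrajectory_pos_mom hα x₀ w
  have h1 := ((((hasDerivAt_id t).const_mul w.1).add_const x₀).mul (h.hasDerivAt_mom t ht)).sub
    ((h.hasDerivAt_pos t ht).const_mul w.1)
  refine h1.congr_deriv ?_
  simp only [id]
  ring

/-- If the extremal is conjugate at time `1`, then `conj hα x₀ w` changes sign there. Its derivative
is a multiple of `(w.1 * t + x₀) * force α (pos hα x₀ w t)`; the two factors either are both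
nonzero at `1` or both change sign at `1`. -/
lemma not_eventually_conj_nonneg (hw : w.2 ≠ 0) (hE : energy α x₀ w ≠ 0)
    (h1 : conj hα x₀ w 1 = 0) {σ : ℝ} (hσ : σ ≠ 0) :
    ¬ ∀ᶠ t in 𝓝 1, 0 ≤ σ * conj hα x₀ w t := by
  have hone : (1 : ℝ) ∈ Ioo (-2 : ℝ) 2 := by norm_num
  have hN : ∀ᶠ t in 𝓝 (1 : ℝ), HasDerivAt (conj hα x₀ w)
      (-(w.2 ^ 2) * ((w.1 * t + x₀) * force α (pos hα x₀ w t))) t :=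
    eventually_of_mem (isOpen_Ioo.mem_nhds hone) fun t ht => hasDerivAt_conj hα x₀ w ht
  have htraj := isTrajectory_pos_mom hα x₀ w
  have hposc : ContinuousAt (pos hα x₀ w) 1 := (htraj.hasDerivAt_pos 1 hone).continuousAt
  have hw2 : 0 < w.2 ^ 2 := by positivity
  suffices hs : ∃ c : ℝ, ∀ᶠ t in 𝓝[≠] (1 : ℝ),
      0 < c * ((w.1 * t + x₀) * force α (pos hα x₀ w t)) by
    obtain ⟨c, hc⟩ := hs
    refine not_eventually_nonneg_of_deriv_sign hN (c := -c) (hc.mono fun t ht => ?_) h1 hσ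
    have : -c * (-(w.2 ^ 2) * ((w.1 * t + x₀) * force α (pos hα x₀ w t))) =
      w.2 ^ 2 * (c * ((w.1 * t + x₀) * force α (pos hα x₀ w t))) := by ring
    rw [this]
    positivity
  by_cases hpos : pos hα x₀ w 1 = 0
  · have hmom : mom hα x₀ w 1 ≠ 0 := by
      intro hmom
      apply hE
      rw [← energy_end hα x₀ w, hpos, hmom, abs_zero, Real.zero_rpow (by linarith)]
      ring
    have hux : w.1 + x₀ = 0 := by
      rw [conj, hpos] at h1
      have : (w.1 * 1 + x₀) * mom hα x₀ w 1 = 0 := by linarith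
      simpa [hmom] using this
    have hu : w.1 ≠ 0 := by
      intro hu
      apply hE
      have hx : x₀ = 0 := by linarith
      rw [energy, hu, hx, abs_zero, Real.zero_rpow (by linarith)]
      ring
    -- near `1`, `pos` has the sign of `mom 1 * (t - 1)`
    have hslope := hasDerivAt_iff_tendsto_slope.1 (htraj.hasDerivAt_pos 1 hone)
    have hev := (hslope.const_mul (mom hα x₀ w 1)).eventually (lt_mem_nhds (mul_self_pos.2 hmom))
    refine ⟨w.1 * mom hα x₀ w 1, ?_⟩
    filter_upwards [hev, self_mem_nhdsWithin] with t ht hne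
    have hne : t - 1 ≠ 0 := sub_ne_zero.2 hne
    rw [slope_def_field, hpos, sub_zero] at ht
    have hxt : pos hα x₀ w t ≠ 0 := by
      intro h
      simp [h] at ht
    have hlin : w.1 * t + x₀ = w.1 * (t - 1) := by linarith
    have hP : 0 < α * |pos hα x₀ w t| ^ (2 * α - 2) :=
      mul_pos (by linarith) (Real.rpow_pos_of_pos (abs_pos.2 hxt) _)
    have hkey : w.1 * mom hα x₀ w 1 * ((w.1 * t + x₀) * force α (pos hα x₀ w t)) =
        (w.1 * (t - 1)) ^ 2 * (α * |pos hα x₀ w t| ^ (2 * α - 2)) *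
          (mom hα x₀ w 1 * (pos hα x₀ w t / (t - 1))) := by
      rw [hlin, force]
      field_simp
    rw [hkey]
    have : 0 < (w.1 * (t - 1)) ^ 2 := by positivity
    positivity
  · have hux : w.1 + x₀ ≠ 0 := by
      intro hux
      have hu : w.1 = 0 := by
        rw [conj, mul_one, hux, zero_mul, zero_sub, neg_eq_zero] at h1
        exact (mul_eq_zero.1 h1).resolve_right hpos
      apply hE
      have hx : x₀ = 0 := by linarith
      rw [energy, hu, hx, abs_zero, Real.zero_rpow (by linarith)]
      ring
    set k : ℝ → ℝ := fun t => (w.1 * t + x₀) * force α (pos hα x₀ w t) with hk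
    have hk1 : k 1 ≠ 0 := by
      simp only [hk, mul_one]
      exact mul_ne_zero hux (force_ne_zero hα hpos)
    have hkc : ContinuousAt k 1 :=
      (by fun_prop : ContinuousAt (fun t : ℝ => w.1 * t + x₀) 1).mul
        ((continuous_force hα).continuousAt.comp hposc)
    exact ⟨k 1, nhdsWithin_le_nhds
      ((hkc.const_mul (k 1)).eventually (lt_mem_nhds (mul_self_pos.2 hk1)))⟩

/-- Multiplying the initial covector by `r` reparametrizes the normal extremal. -/
lemma pos_mom_smul {r : ℝ} (hr : r ∈ Ioo (0 : ℝ) 2) :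
    pos hα x₀ (r • w) 1 = pos hα x₀ w r ∧ mom hα x₀ (r • w) 1 = r * mom hα x₀ w r := by
  have htraj := isTrajectory_pos_mom hα x₀ w
  have hmem : ∀ t ∈ Icc (0 : ℝ) 1, r * t ∈ Ioo (-2 : ℝ) 2 := by
    intro t ht
    have k1 : 0 ≤ r * t := mul_nonneg hr.1.le ht.1
    have k2 : r * t ≤ r * 1 := mul_le_mul_of_nonneg_left ht.2 hr.1.le
    constructor <;> linarith [hr.2]
  have htime : ∀ t : ℝ, HasDerivAt (fun t => r * t) r t := fun t => by
    simpa using (hasDerivAt_id t).const_mul r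
  have key := pos_mom_eq hα x₀ (r • w) (x := fun t => pos hα x₀ w (r * t))
    (p := fun t => r * mom hα x₀ w (r * t))
    (fun t ht => ((htraj.hasDerivAt_pos _ (hmem t ht)).comp t (htime t)).congr_deriv (by ring))
    (fun t ht => (((htraj.hasDerivAt_mom _ (hmem t ht)).comp t (htime t)).const_mul r).congr_deriv
      (by simp; ring))
    (by simp [pos_zero]) (by simp [mom_zero]) (t := 1) (by norm_num)
  simpa using key

lemma conj_smul {r : ℝ} (hr : r ∈ Ioo (0 : ℝ) 2) :
    conj hα x₀ (r • w) 1 = r * conj hα x₀ w r := by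
  obtain ⟨h1, h2⟩ := pos_mom_smul hα x₀ w hr
  simp only [conj, h1, h2, Prod.smul_fst, smul_eq_mul]
  ring

/-- Coordinates on covectors in which `(r, 0)` is the covector `r • w`. -/
noncomputable def radialCoord (hw : w.2 ≠ 0) : (ℝ × ℝ) ≃L[ℝ] (ℝ × ℝ) :=
  planeEquiv w.1 1 w.2 0 (by simpa using hw)

lemma radialCoord_apply (hw : w.2 ≠ 0) (z : ℝ × ℝ) :
    radialCoord w hw z = z.1 • w + z.2 • ((1, 0) : ℝ × ℝ) := by
  rw [radialCoord, planeEquiv_apply]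
  ext <;> simp [mul_comm]

lemma fderiv_comp_radialCoord (hw : w.2 ≠ 0) {f : ℝ × ℝ → ℝ} {z : ℝ × ℝ}
    (hf : DifferentiableAt ℝ f (radialCoord w hw z)) (h : ℝ × ℝ) :
    fderiv ℝ (fun z => f (radialCoord w hw z)) z h =
      fderiv ℝ f (radialCoord w hw z) (radialCoord w hw h) := by
  have := (hf.hasFDerivAt.comp z (radialCoord w hw).hasFDerivAt).fderiv
  change fderiv ℝ (f ∘ radialCoord w hw) z h = _
  rw [this]
  rfl

/-- Near a conjugate covector with `w.2 ≠ 0`, the exponential map is not injective: along the ray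
through `w` its Jacobian determinant changes sign at `w`, whereas its derivative at `w` does not
vanish in the direction of the ray. -/
theorem not_injOn_of_conj_eq_zero (hw : w.2 ≠ 0) (hE : energy α x₀ w ≠ 0)
    (h1 : conj hα x₀ w 1 = 0) {U : Set (ℝ × ℝ)} (hU : U ∈ 𝓝 w) :
    ¬ InjOn (fun z => (pos hα x₀ z 1, vert hα x₀ z)) U := by
  intro hinj
  set B := radialCoord w hw with hB
  have hBr : ∀ r : ℝ, B (r, 0) = r • w := fun r => by rw [hB, radialCoord_apply]; simp
  have hB1 : B (1, 0) = w := by rw [hBr, one_smul]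
  have hB01 : B (0, 1) = (1, 0) := by rw [hB, radialCoord_apply]; simp
  set a : ℝ × ℝ → ℝ := fun z => pos hα x₀ (B z) 1 with ha
  set b : ℝ × ℝ → ℝ := fun z => vert hα x₀ (B z) with hb
  have hac : ContDiffAt ℝ 1 a (1, 0) := by
    have h := contDiffAt_pos hα x₀ w hw hE
    rw [← hB1] at h
    exact h.comp _ B.contDiff.contDiffAt
  have hbc : ContDiffAt ℝ 1 b (1, 0) := by
    have h := contDiffAt_vert hα x₀ w hw hE
    rw [← hB1] at h
    exact h.comp _ B.contDiff.contDiffAt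
  have hU' : B ⁻¹' U ∈ 𝓝 ((1 : ℝ), (0 : ℝ)) :=
    B.continuous.continuousAt.preimage_mem_nhds (by rwa [hB1])
  have hinj' : InjOn (fun z => (a z, b z)) (B ⁻¹' U) := fun z hz z' hz' h =>
    B.injective (hinj hz hz' h)
  -- the Jacobian determinant along the ray
  have hjac : ∀ r ∈ Ioo (0 : ℝ) 2, jacobian a b (r, 0) = conj hα x₀ w r / (α * r * w.2) := by
    intro r hr
    have hr0 : r ≠ 0 := hr.1.ne'
    have hw' : (r • w).2 ≠ 0 := by simp [hr0, hw]
    have hE' : energy α x₀ (r • w) ≠ 0 := by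
      have hpos : 0 < energy α x₀ w := lt_of_le_of_ne (by rw [energy]; positivity) hE.symm
      refine (energy_pos ?_ hw').ne'
      rintro h
      have hx : x₀ = 0 := congrArg Prod.fst h
      have hu : r * w.1 = 0 := congrArg Prod.snd h
      have hu : w.1 = 0 := by simpa [hr0] using hu
      apply hE
      rw [energy, hu, hx, abs_zero, Real.zero_rpow (by linarith)]
      ring
    have hda := (contDiffAt_pos hα x₀ _ hw' hE').differentiableAt one_ne_zero
    have hdb := (contDiffAt_vert hα x₀ _ hw' hE').differentiableAt one_ne_zero
    have hdet := det_eq_conj hα x₀ (r • w) hw' hE'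
    rw [conj_smul hα x₀ w hr, map_smul, map_smul] at hdet
    rw [← hBr r] at hda hdb
    rw [jacobian, ha, hb, fderiv_comp_radialCoord w hw hda, fderiv_comp_radialCoord w hw hda,
      fderiv_comp_radialCoord w hw hdb, fderiv_comp_radialCoord w hw hdb, ← hB, hB1, hB01, hBr]
    simp only [Prod.smul_snd, smul_eq_mul] at hdet
    have hα0 : α ≠ 0 := by linarith
    refine mul_left_cancel₀ hr0 ?_
    rw [mul_sub, ← mul_assoc, mul_left_comm, hdet]
    field_simp
  have hray : Tendsto (fun r : ℝ => (r, (0 : ℝ))) (𝓝 1) (𝓝 (1, 0)) :=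
    (by fun_prop : Continuous fun r : ℝ => (r, (0 : ℝ))).tendsto 1
  have hcontra : ∀ σ : ℝ, σ ≠ 0 → ¬ ∀ᶠ z in 𝓝 ((1 : ℝ), (0 : ℝ)), 0 ≤ σ * jacobian a b z := by
    intro σ hσ h
    refine not_eventually_conj_nonneg hα x₀ w hw hE h1 (div_ne_zero hσ hw) ?_
    have hmem : ∀ᶠ r in 𝓝 (1 : ℝ), r ∈ Ioo (0 : ℝ) 2 := isOpen_Ioo.mem_nhds (by norm_num)
    filter_upwards [hray.eventually h, hmem] with r hr hr2
    rw [hjac r hr2] at hr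
    have hα0 : 0 < α := by linarith
    have hid : σ / w.2 * conj hα x₀ w r =
        α * r * (σ * (conj hα x₀ w r / (α * r * w.2))) := by
      have := hr2.1.ne'
      field_simp
    rw [hid]
    exact mul_nonneg (mul_nonneg hα0.le hr2.1.le) hr
  have hda := (contDiffAt_pos hα x₀ _ hw hE).differentiableAt one_ne_zero
  have hdb := (contDiffAt_vert hα x₀ _ hw hE).differentiableAt one_ne_zero
  rw [← hB1] at hda hdb
  have ha1 : fderiv ℝ a (1, 0) (1, 0) = mom hα x₀ w 1 := by
    rw [ha, fderiv_comp_radialCoord w hw hda, ← hB, hB1, fderiv_pos_radial hα x₀ w hw hE]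
  have hb1 : fderiv ℝ b (1, 0) (1, 0) = w.2 * |pos hα x₀ w 1| ^ (2 * α) := by
    rw [hb, fderiv_comp_radialCoord w hw hdb, ← hB, hB1, fderiv_vert_radial hα x₀ w hw hE]
  by_cases hmom : mom hα x₀ w 1 = 0
  · have hne : fderiv ℝ b (1, 0) (1, 0) ≠ 0 := by
      rw [hb1]
      intro h
      apply hE
      rw [← energy_end hα x₀ w, hmom]
      linear_combination w.2 * h
    have hinj2 : InjOn (fun z => (b z, a z)) (B ⁻¹' U) := fun z hz z' hz' h =>
      hinj' hz hz' (Prod.ext (congrArg Prod.snd h) (congrArg Prod.fst h))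
    obtain ⟨σ, hσ, h⟩ := exists_sign_jacobian_of_injOn hbc hac hne hU' hinj2
    refine hcontra (-σ) (neg_ne_zero.2 hσ) (h.mono fun z hz => hz.trans_eq ?_)
    rw [jacobian, jacobian]
    ring
  · obtain ⟨σ, hσ, h⟩ := exists_sign_jacobian_of_injOn hac hbc (by rwa [ha1]) hU' hinj'
    exact hcontra σ hσ h

/-- A covector with `w.2 ≠ 0` and nonconstant extremal is conjugate only if `conj` vanishes. -/
lemma conj_eq_zero_of_ker_ne_bot (y₀ : ℝ) (hw : w.2 ≠ 0) (hE : energy α x₀ w ≠ 0)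
    (hker : LinearMap.ker
      (fderiv ℝ (expMap (grushinFields α) (x₀, y₀)) (covector w)).toLinearMap ≠ ⊥) :
    conj hα x₀ w 1 = 0 := by
  have hda := (contDiffAt_pos hα x₀ _ hw hE).differentiableAt one_ne_zero
  have hdb := (contDiffAt_vert hα x₀ _ hw hE).differentiableAt one_ne_zero
  have hF := hda.hasFDerivAt.prodMk (hdb.hasFDerivAt.const_add y₀)
  have hev : (fun z => expMap (grushinFields α) (x₀, y₀) (covector z)) =ᶠ[𝓝 w]
      fun z => (pos hα x₀ z 1, y₀ + vert hα x₀ z) := by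
    filter_upwards [(continuous_snd.continuousAt (x := w)).eventually (isOpen_ne.mem_nhds hw)]
      with z hz
    exact expMap_covector_of_ne_zero hα x₀ z y₀ hz
  obtain ⟨h, hne, hzero⟩ := exists_ne_zero_of_ker_ne_bot (hF.congr_of_eventuallyEq hev) hker
  have hdec : h = (h.2 / w.2) • w + (h.1 - h.2 / w.2 * w.1) • ((1, 0) : ℝ × ℝ) := by
    ext
    · simp
    · simp [hw]
  have hA : (fderiv ℝ (fun z => pos hα x₀ z 1) w) h = 0 := congrArg Prod.fst hzero
  have hB : (fderiv ℝ (vert hα x₀) w) h = 0 := congrArg Prod.snd hzero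
  rw [hdec, map_add, map_smul, map_smul, smul_eq_mul, smul_eq_mul] at hA hB
  have hdet := det_eq_conj hα x₀ w hw hE
  set A := fderiv ℝ (fun z => pos hα x₀ z 1) w w
  set A' := fderiv ℝ (fun z => pos hα x₀ z 1) w (1, 0)
  set D := fderiv ℝ (vert hα x₀) w w
  set D' := fderiv ℝ (vert hα x₀) w (1, 0)
  have hprod : A * D' - A' * D = 0 := by
    by_contra hne'
    have k1 : h.2 / w.2 * (A * D' - A' * D) = 0 := by linear_combination D' * hA - A' * hB
    have k2 : (h.1 - h.2 / w.2 * w.1) * (A * D' - A' * D) = 0 := by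
      linear_combination A * hB - D * hA
    have k3 := (mul_eq_zero.1 k1).resolve_right hne'
    have k4 := (mul_eq_zero.1 k2).resolve_right hne'
    rw [k4, k3] at hdec
    exact hne (by simpa using hdec)
  rw [hprod, eq_comm, div_eq_zero_iff] at hdet
  exact hdet.resolve_right (mul_ne_zero (by linarith) hw)

end

/-! ### Horizontal covectors and the conclusion -/

/-- For small `w.2` the horizontal coordinate is close to its free motion, to second order. -/
lemma exists_abs_pos_sub_le {α : ℝ} (hα : 1 ≤ α) (x₀ u₀ : ℝ) :
    ∃ K : ℝ, ∀ᶠ w : ℝ × ℝ in 𝓝 (u₀, 0), ∀ t ∈ Icc (0 : ℝ) 1,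
    |pos hα x₀ w t| ≤ K ∧ |pos hα x₀ w t - (x₀ + w.1 * t)| ≤ K * w.2 ^ 2 := by
  set c := Real.sqrt (u₀ ^ 2 + 1) with hc
  have hc2 : c ^ 2 = u₀ ^ 2 + 1 := Real.sq_sqrt (by positivity)
  have hc0 : 0 ≤ c := Real.sqrt_nonneg _
  set R := |x₀| + c with hR
  have hR0 : 0 ≤ R := by positivity
  obtain ⟨B, hB⟩ := isCompact_Icc.exists_bound_of_continuousOn
    ((continuous_force hα).continuousOn (s := Icc (-R) R))
  have hB0 : 0 ≤ B := (norm_nonneg _).trans (hB 0 ⟨by linarith, hR0⟩)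
  have hE : ∀ᶠ w : ℝ × ℝ in 𝓝 (u₀, 0), energy α x₀ w < u₀ ^ 2 + 1 :=
    (continuous_energy x₀).continuousAt.eventually (gt_mem_nhds (by simp [energy]))
  refine ⟨max R B, hE.mono fun w hw => ?_⟩
  have hcv : Convex ℝ (Icc (0 : ℝ) 1) := convex_Icc _ _
  have hzero : (0 : ℝ) ∈ Icc (0 : ℝ) 1 := by norm_num
  have htraj := isTrajectory_pos_mom hα x₀ w
  have hmom : ∀ t ∈ Icc (0 : ℝ) 1, |mom hα x₀ w t| ≤ c := by
    intro t ht
    refine abs_le_of_sq_le_sq ?_ hc0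
    have h1 := energy_pos_mom hα x₀ w (Icc_subset_Ioo_two ht)
    have h2 : 0 ≤ w.2 ^ 2 * |pos hα x₀ w t| ^ (2 * α) := by positivity
    rw [energy] at hw
    linarith
  have hpos : ∀ t ∈ Icc (0 : ℝ) 1, |pos hα x₀ w t| ≤ R := by
    intro t ht
    have h := hcv.norm_image_sub_le_of_norm_hasDerivWithin_le (C := c)
      (fun s hs => (htraj.hasDerivAt_pos s (Icc_subset_Ioo_two hs)).hasDerivWithinAt) hmom hzero ht
    rw [pos_zero, sub_zero, Real.norm_eq_abs, Real.norm_eq_abs, abs_of_nonneg ht.1] at h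
    have h2 : c * t ≤ c * 1 := mul_le_mul_of_nonneg_left ht.2 hc0
    have h3 := abs_sub_abs_le_abs_sub (pos hα x₀ w t) x₀
    linarith
  have hdiff : ∀ t ∈ Icc (0 : ℝ) 1, |mom hα x₀ w t - w.1| ≤ w.2 ^ 2 * B := by
    intro t ht
    have h := hcv.norm_image_sub_le_of_norm_hasDerivWithin_le (C := w.2 ^ 2 * B)
      (fun s hs => (htraj.hasDerivAt_mom s (Icc_subset_Ioo_two hs)).hasDerivWithinAt)
      (fun s hs => by
        rw [Real.norm_eq_abs, abs_neg, abs_mul, abs_of_nonneg (sq_nonneg w.2)]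
        exact mul_le_mul_of_nonneg_left (hB _ (abs_le.1 (hpos s hs))) (sq_nonneg _)) hzero ht
    rw [mom_zero, sub_zero, Real.norm_eq_abs, Real.norm_eq_abs, abs_of_nonneg ht.1] at h
    exact h.trans (mul_le_of_le_one_right (by positivity) ht.2)
  intro t ht
  refine ⟨(hpos t ht).trans (le_max_left _ _), ?_⟩
  have h := hcv.norm_image_sub_le_of_norm_hasDerivWithin_le (C := w.2 ^ 2 * B)
    (f := fun t => pos hα x₀ w t - (x₀ + w.1 * t))
    (f' := fun t => mom hα x₀ w t - w.1)
    (fun s hs => by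
      have h1 := ((hasDerivAt_id s).const_mul w.1).const_add x₀
      have h2 := (htraj.hasDerivAt_pos s (Icc_subset_Ioo_two hs)).sub h1
      exact (h2.congr_deriv (by simp)).hasDerivWithinAt) hdiff hzero ht
  simp only [pos_zero, mul_zero, add_zero, sub_self, sub_zero, Real.norm_eq_abs,
    abs_of_nonneg ht.1] at h
  calc |pos hα x₀ w t - (x₀ + w.1 * t)| ≤ w.2 ^ 2 * B * t := h
    _ ≤ w.2 ^ 2 * B := mul_le_of_le_one_right (by positivity) ht.2
    _ = B * w.2 ^ 2 := mul_comm _ _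
    _ ≤ max R B * w.2 ^ 2 := by
      gcongr
      exact le_max_right _ _

/-- A covector `(u₀, 0)` with `(x₀, u₀) ≠ 0` is not conjugate: there
the derivative of the exponential map is diagonal, with entries `1` and
`∫ t in 0..1, |x₀ + u₀ * t| ^ (2 * α)`. -/
theorem ker_eq_bot_of_snd_eq_zero {α : ℝ} (hα : 1 ≤ α) (x₀ : ℝ) {u₀ : ℝ} (y₀ : ℝ)
    (h0 : (x₀, u₀) ≠ 0) :
    LinearMap.ker
      (fderiv ℝ (expMap (grushinFields α) (x₀, y₀)) (covector (u₀, 0))).toLinearMap = ⊥ := by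
  obtain ⟨K, hK⟩ := exists_abs_pos_sub_le hα x₀ u₀
  set J : ℝ × ℝ → ℝ := fun w => ∫ s in (0 : ℝ)..1, |pos hα x₀ w s| ^ (2 * α) with hJ
  have hα2 : 0 < 2 * α := by linarith
  have hfree : ∀ t ∈ Icc (0 : ℝ) 1, pos hα x₀ (u₀, 0) t = x₀ + u₀ * t := by
    intro t ht
    have := (hK.self_of_nhds t ht).2
    simpa [sub_eq_zero] using this
  have hsnd : ∀ w : ℝ × ℝ, |w.2| ≤ ‖w - (u₀, 0)‖ := by
    intro w
    have h := norm_snd_le (w - (u₀, (0 : ℝ)))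
    rwa [Prod.snd_sub, sub_zero] at h
  have hpos : HasFDerivAt (fun w => pos hα x₀ w 1) (ContinuousLinearMap.fst ℝ ℝ ℝ) (u₀, 0) := by
    have hO : (fun w : ℝ × ℝ => pos hα x₀ w 1 - (x₀ + w.1)) =O[𝓝 (u₀, 0)]
        fun w => ‖w - (u₀, 0)‖ ^ 2 := by
      refine Asymptotics.IsBigO.of_bound |K| (hK.mono fun w hw => ?_)
      have h1 := (hw 1 (by norm_num)).2
      rw [mul_one] at h1
      have h3 : w.2 ^ 2 ≤ ‖w - (u₀, 0)‖ ^ 2 := by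
        rw [← sq_abs w.2]
        gcongr
        exact hsnd w
      rw [Real.norm_eq_abs, Real.norm_of_nonneg (by positivity)]
      refine h1.trans ?_
      gcongr
      exact le_abs_self K
    have h1 := Asymptotics.IsBigO.hasFDerivAt (𝕜 := ℝ) hO one_lt_two
    have h2 : HasFDerivAt (fun w : ℝ × ℝ => x₀ + w.1) (ContinuousLinearMap.fst ℝ ℝ ℝ) (u₀, 0) :=
      hasFDerivAt_fst.const_add x₀
    have h3 := h1.add h2
    rw [zero_add] at h3
    refine h3.congr_of_eventuallyEq (Eventually.of_forall fun w => ?_)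
    simp
  have hJc : ContinuousAt J (u₀, 0) := by
    refine intervalIntegral.continuousAt_of_dominated_interval (bound := fun _ => K ^ (2 * α))
      ?_ ?_ intervalIntegrable_const ?_
    · refine Eventually.of_forall fun w => ?_
      have hc := (isTrajectory_pos_mom hα x₀ w).continuousOn_abs_rpow hα
      rw [uIoc_of_le zero_le_one]
      exact (hc.mono (Ioc_subset_Icc_self.trans Icc_subset_Ioo_two)).aestronglyMeasurable
        measurableSet_Ioc
    · filter_upwards [hK] with w hw
      refine Eventually.of_forall fun t ht => ?_
      rw [uIoc_of_le zero_le_one] at ht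
      rw [Real.norm_of_nonneg (by positivity)]
      exact Real.rpow_le_rpow (abs_nonneg _) (hw t (Ioc_subset_Icc_self ht)).1 hα2.le
    · refine Eventually.of_forall fun t ht => ?_
      rw [uIoc_of_le zero_le_one] at ht
      have ht := Ioc_subset_Icc_self ht
      have hlim : ContinuousAt (fun w => pos hα x₀ w t) (u₀, 0) := by
        have h1 : Tendsto (fun w => pos hα x₀ w t - (x₀ + w.1 * t)) (𝓝 (u₀, 0)) (𝓝 0) := by
          refine squeeze_zero_norm' (a := fun w : ℝ × ℝ => K * w.2 ^ 2)
            (hK.mono fun w hw => (hw t ht).2) ?_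
          have : Continuous fun w : ℝ × ℝ => K * w.2 ^ 2 := by fun_prop
          simpa using this.tendsto (u₀, 0)
        have h2 : Tendsto (fun w : ℝ × ℝ => x₀ + w.1 * t) (𝓝 (u₀, 0)) (𝓝 (x₀ + u₀ * t)) :=
          (by fun_prop : Continuous fun w : ℝ × ℝ => x₀ + w.1 * t).tendsto (u₀, 0)
        have h3 := h1.add h2
        rw [ContinuousAt, hfree t ht]
        simpa using h3
      exact hlim.abs.rpow_const (Or.inr hα2.le)
  have hJpos : 0 < J (u₀, 0) := by
    have hc := (isTrajectory_pos_mom hα x₀ (u₀, 0)).continuousOn_abs_rpow hα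
    refine intervalIntegral.integral_pos one_pos (hc.mono Icc_subset_Ioo_two)
      (fun t _ => by positivity) ?_
    suffices h : ∃ t ∈ Icc (0 : ℝ) 1, x₀ + u₀ * t ≠ 0 by
      obtain ⟨t, ht, hne⟩ := h
      refine ⟨t, ht, ?_⟩
      rw [hfree t ht]
      exact Real.rpow_pos_of_pos (abs_pos.2 hne) _
    by_cases hx : x₀ = 0
    · refine ⟨1, by norm_num, fun h => h0 ?_⟩
      have hu : u₀ = 0 := by linarith
      rw [hx, hu]
      rfl
    · exact ⟨0, by norm_num, by simpa using hx⟩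
  have hvert : HasFDerivAt (fun w : ℝ × ℝ => w.2 * J w)
      (J (u₀, 0) • ContinuousLinearMap.snd ℝ ℝ ℝ) (u₀, 0) := by
    rw [hasFDerivAt_iff_isLittleO]
    have h1 : (fun w : ℝ × ℝ => w.2) =O[𝓝 (u₀, 0)] fun w => w - (u₀, 0) := by
      refine Asymptotics.IsBigO.of_bound 1 (Eventually.of_forall fun w => ?_)
      rw [one_mul]
      exact hsnd w
    have h2 : (fun w => J w - J (u₀, 0)) =o[𝓝 (u₀, 0)] fun _ => (1 : ℝ) := by
      rw [Asymptotics.isLittleO_one_iff]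
      simpa using hJc.tendsto.sub_const (J (u₀, 0))
    have h3 := h1.norm_right.mul_isLittleO h2
    simp only [mul_one] at h3
    refine h3.of_norm_right.congr_left fun w => ?_
    simp
    ring
  have hF := hpos.prodMk (hvert.const_add y₀)
  have heq : (fun w => expMap (grushinFields α) (x₀, y₀) (covector w)) =
      fun w => (pos hα x₀ w 1, y₀ + w.2 * J w) := funext fun w => expMap_covector hα x₀ w y₀
  rw [← heq] at hF
  by_contra hker
  obtain ⟨h, hne, hzero⟩ := exists_ne_zero_of_ker_ne_bot hF hker
  have e1 : h.1 = 0 := congrArg Prod.fst hzero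
  have e2 : J (u₀, 0) * h.2 = 0 := congrArg Prod.snd hzero
  exact hne (Prod.ext e1 ((mul_eq_zero.1 e2).resolve_left hJpos.ne'))

/-- From a point of the singular line `x = 0`, the covectors `v dy` all have constant extremals. -/
lemma expMap_covector_zero {α : ℝ} (hα : 1 ≤ α) (y₀ v : ℝ) :
    expMap (grushinFields α) (0, y₀) (covector (0, v)) = (0, y₀) := by
  have h : IsTrajectory α v (fun _ => 0) fun _ => 0 :=
    ⟨fun t _ => hasDerivAt_const t 0, fun t _ => by
      simpa [force_zero] using hasDerivAt_const t (0 : ℝ)⟩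
  rw [h.expMap_eq hα y₀]
  simp [Real.zero_rpow (by linarith : 2 * α ≠ 0)]

/-- The exponential map is not injective near any conjugate covector. -/
theorem not_injOn_expMap {α : ℝ} (hα : 1 ≤ α) (x₀ y₀ : ℝ) (w : ℝ × ℝ)
    (hker : LinearMap.ker
      (fderiv ℝ (expMap (grushinFields α) (x₀, y₀)) (covector w)).toLinearMap ≠ ⊥)
    {U : Set (StrongDual ℝ (ℝ × ℝ))} (hU : U ∈ 𝓝 (covector w)) :
    ¬ InjOn (expMap (grushinFields α) (x₀, y₀)) U := by
  intro hinj
  have hU' : covector ⁻¹' U ∈ 𝓝 w := covector.continuous.continuousAt.preimage_mem_nhds hU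
  by_cases h0 : (x₀, w.1) = 0
  · obtain rfl : x₀ = 0 := congrArg Prod.fst h0
    have hw1 : w.1 = 0 := congrArg Prod.snd h0
    obtain ⟨v, hv, hne⟩ : ∃ v, (0, v) ∈ covector ⁻¹' U ∧ v ≠ w.2 := by
      have hlim : Tendsto (fun v : ℝ => ((0 : ℝ), v)) (𝓝[≠] w.2) (𝓝 w) := by
        have h : Tendsto (fun v : ℝ => ((0 : ℝ), v)) (𝓝 w.2) (𝓝 (0, w.2)) :=
          (by fun_prop : Continuous fun v : ℝ => ((0 : ℝ), v)).tendsto w.2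
        rw [show ((0 : ℝ), w.2) = w from Prod.ext hw1.symm rfl] at h
        exact h.mono_left nhdsWithin_le_nhds
      exact ((hlim.eventually hU').and self_mem_nhdsWithin).exists
    have hw : w = (0, w.2) := Prod.ext hw1 rfl
    have hwU : covector (0, w.2) ∈ U := hw ▸ mem_of_mem_nhds hU
    have := covector.injective (hinj hv hwU
      ((expMap_covector_zero hα y₀ v).trans (expMap_covector_zero hα y₀ w.2).symm))
    exact hne (congrArg Prod.snd this)
  · by_cases hw : w.2 = 0
    · refine hker ?_
      rw [show w = (w.1, 0) from Prod.ext rfl hw]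
      exact ker_eq_bot_of_snd_eq_zero hα x₀ y₀ h0
    · have hE := (energy_pos (α := α) h0 hw).ne'
      have hne : ∀ᶠ z : ℝ × ℝ in 𝓝 w, z.2 ≠ 0 :=
        continuousAt_snd.eventually (isOpen_ne.mem_nhds hw)
      refine not_injOn_of_conj_eq_zero hα x₀ w hw hE
        (conj_eq_zero_of_ker_ne_bot hα x₀ w y₀ hw hE hker) (inter_mem hU' hne) ?_
      intro z hz z' hz' h
      refine covector.injective (hinj hz.1 hz'.1 ?_)
      rw [expMap_covector_of_ne_zero hα x₀ z y₀ hz.2, expMap_covector_of_ne_zero hα x₀ z' y₀ hz'.2]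
      have h1 : pos hα x₀ z 1 = pos hα x₀ z' 1 := congrArg Prod.fst h
      have h2 : vert hα x₀ z = vert hα x₀ z' := congrArg Prod.snd h
      rw [h1, h2]

end Grushin

theorem mainTheorem4 (α : ℝ) (hα : 1 ≤ α) (q : ℝ × ℝ) :
    SubRiem.expDomain (SubRiem.grushinFields α) q = Set.univ ∧
    ∀ l ∈ SubRiem.conjugateLocus (SubRiem.grushinFields α) q,
      ∀ U ∈ nhds l, ¬ Set.InjOn (SubRiem.expMap (SubRiem.grushinFields α) q) U := by
  refine ⟨Grushin.expDomain_eq_univ hα q, fun l hl U hU => ?_⟩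
  obtain ⟨w, rfl⟩ := Grushin.covector.surjective l
  exact Grushin.not_injOn_expMap hα q.1 q.2 w hl.2 hU
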